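/- Let $H$ be a complex $n_r\times n_t$ matrix of rank $n_r$ with $1\le n_r<n_t$, let $G=H^*H$, let $\|G\|$ be its spectral norm, let $m=(n_t^2-n_t)/2$, and let $\delta$ be one third of the smallest distance between distinct eigenvalues of $G$. For $l<r$ let $R_{l,r}(\theta,\phi)$ be the unitary matrix that equals the identity except for the entries $(l,l),(r,r)$, equal to $\cos\theta$, the entry $(r,l)$, equal to $e^{-i\phi}\sin\theta$, and the entry $(l,r)$, equal to $-e^{i\phi}\sin\theta$; let $r_{l,r}(\theta,\phi)$ be its $l$-th column. The modified one-bit null space learning algorithm (OBNSLA) with line search accuracy $\eta\ge 0$ produces unitary matrices $W_0=I,W_1,W_2,\dots$ as follows; write $A_k=W_k^*GW_k$. A sweep consists of $m$ consecutive steps, in which the pairs $(l,r)$, $l<r$, are taken in the row-cyclic order $(1,2),(1,3),\dots,(1,n_t),(2,3),\dots,(n_t-1,n_t)$; the same order is used in every sweep. The step from $W_k$ with the pair $(l,r)$ multiplies $W_k$ on the right by $R_{l,r}(\hat\theta,\hat\phi)$, where $\hat\theta,\hat\phi$ are any angles such that * $|\hat\phi-\phi^{J}|\le\eta$ for some minimizer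 $\phi^{J}$ of $\phi\mapsto r_{l,r}(\pi/4,\phi)^*A_k\,r_{l,r}(\pi/4,\phi)$ over $[-\pi,\pi]$, and * $|\hat\theta-T|\le\eta$, where for some minimizer $\tilde\theta$ of $\theta\mapsto r_{l,r}(\theta,\hat\phi)^*A_k\,r_{l,r}(\theta,\hat\phi)$ over $[-\pi/2,\pi/2]$ one has $T=\tilde\theta$ if $|\tilde\theta|\le\pi/4$ and $T=\tilde\theta-\operatorname{sign}(\tilde\theta)\pi/2$ otherwise. In this step the diagonal entries $a_{ll},a_{rr}$ of $A_k$ are also compared: column $l$ wins against column $r$ if $a_{ll}\ge a_{rr}$, otherwise column $r$ wins against column $l$. At the end of each sweep the columns of the current matrix are sorted in decreasing order according to the comparisons of this sweep, that is, they are permuted in such a way that, whenever each column of some set has won against each column outside the set, the columns of the set come first. (If the comparisons are transitive, this determines the permutation.) For $k\in m\mathbb{N}$, $W_k$ denotes the matrix after this permutation. Let $P_k$ be the Frobenius norm of the strictly upper triangular part of $A_k$. There are constants $C,c>0$ that depend only on $n_t$ such that the following holds for every run of the algorithm. Let $k$ be a multiple of $m$ (the beginning of a sweep) with $P_k^2<\delta^2/8$.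 Then $$P_{k+2m}^2\le C\Big(\frac{P_{k+m}^2}{\delta}\Big)^2+C\,\frac{\eta P_{k+m}^{3/2}}{\delta}+C\,\frac{\eta^2P_{k+m}^{1/2}}{\delta}+2(n_t^2-n_t)\eta^2\|G\|^2 .$$ The convergence is quadratic as long as the accuracy is fine enough: if $\eta\|G\|\delta\le P_{k+m}^2$, then $P_{k+2m}\le C\,P_{k+m}^2/\delta$. Furthermore, if $\eta$ is sufficiently small, namely $\eta\|G\|\le c\,\delta$, then the last $n_t-n_r$ columns of $W_{k+m}$ give the minimal interference: $\|Hw_i\|\le\|Hw_j\|$ for all $1\le j\le n_r<i\le n_t$, where $w_i$ is the $i$-th column of $W_{k+m}$. -/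

import Mathlib

noncomputable section

namespace OBNSLA

open Matrix

/-! ### Jacobi rotations and the row-cyclic order -/

/-- The complex plane rotation in the coordinates `l`, `r`: the identity except for the diagonal
entries `(l,l)`, `(r,r)`, equal to `cos θ`, the `(r,l)` entry `exp (-iφ) sin θ` and the `(l,r)`
entry `-exp (iφ) sin θ`. -/
def jacobiRotation {n : ℕ} (l r : Fin n) (θ φ : ℝ) : Matrix (Fin n) (Fin n) ℂ :=
  Matrix.of fun i j =>
    if i = j then (if i = l ∨ i = r then (Real.cos θ : ℂ) else 1)
    else if i = r ∧ j = l then Complex.exp (-(Complex.I * φ)) * (Real.sin θ : ℂ)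
    else if i = l ∧ j = r then -(Complex.exp (Complex.I * φ) * (Real.sin θ : ℂ))
    else 0

/-- The number `m = n (n - 1) / 2` of rotations in one sweep. -/
def sweepLength (n : ℕ) : ℕ := n * (n - 1) / 2

/-- The pairs `(l, r)` with `l < r`, row by row: `(1,2), (1,3), …, (1,n), (2,3), …, (n-1,n)`
(with indices starting at `0`). -/
def rowCyclicPairs (n : ℕ) : List (Fin n × Fin n) :=
  (List.finRange n ×ˢ List.finRange n).filter fun p => p.1 < p.2

/-- One sweep visits exactly `n (n - 1) / 2` pairs. -/
theorem length_rowCyclicPairs (n : ℕ) : (rowCyclicPairs n).length = sweepLength n := by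
  have hnd : (rowCyclicPairs n).Nodup :=
    ((List.nodup_finRange n).product (List.nodup_finRange n)).filter _
  have h1 : (rowCyclicPairs n).toFinset
      = ((Finset.univ : Finset (Fin n)).sigma (fun i => Finset.Ioi i)).map
        (Equiv.sigmaEquivProd (Fin n) (Fin n)).toEmbedding := by
    ext ⟨a, b⟩
    simp [rowCyclicPairs, Equiv.sigmaEquivProd]
  rw [← List.toFinset_card_of_nodup hnd, h1, Finset.card_map, Finset.card_sigma, sweepLength,
    ← Finset.sum_range_id_mul_two n, Nat.mul_div_cancel _ (by norm_num),
    ← Finset.sum_range_reflect]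
  simp only [Fin.card_Ioi]
  rw [Finset.sum_range]

/-- The pair on which the rotation from stage `k` to stage `k + 1` acts: the row-cyclic order,
repeated in every sweep. (The list has length `sweepLength n`, so this is `none` only if `n ≤ 1`.) -/
def pivot (n k : ℕ) : Option (Fin n × Fin n) := (rowCyclicPairs n)[k % sweepLength n]?

/-! ### Line searches of accuracy `η` -/

/-- The quadratic form `S(A, x) = x* A x` (real for Hermitian `A`). -/
def quadForm {n : ℕ} (A : Matrix (Fin n) (Fin n) ℂ) (x : Fin n → ℂ) : ℝ :=
  (star x ⬝ᵥ (A *ᵥ x)).re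

/-- The rotation angle obtained from a minimizer `t ∈ [-π/2, π/2]`: `t` itself if
`-π/4 ≤ t ≤ π/4`, and `t - sign(t) π/2` otherwise. -/
def foldAngle (t : ℝ) : ℝ :=
  if -(Real.pi / 4) ≤ t ∧ t ≤ Real.pi / 4 then t
  else t - (if 0 < t then 1 else -1) * (Real.pi / 2)

/-- `(θ, φ)` are angles which the two line searches of accuracy `η` can return for the pair
`(l, r)` of the matrix `A`: `φ` is within `η` of a minimizer over `[-π, π]` of
`φ' ↦ S(A, r_{l,r}(π/4, φ'))`, and `θ` is within `η` of the folded minimizer over `[-π/2, π/2]` of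
`θ' ↦ S(A, r_{l,r}(θ', φ))`, where `r_{l,r}(θ, φ)` is the `l`-th column of the rotation. -/
def IsLineSearchResult {n : ℕ} (A : Matrix (Fin n) (Fin n) ℂ) (l r : Fin n) (η θ φ : ℝ) : Prop :=
  (∃ φJ ∈ Set.Icc (-Real.pi) Real.pi,
    IsMinOn (fun φ' => quadForm A ((jacobiRotation l r (Real.pi / 4) φ').col l))
      (Set.Icc (-Real.pi) Real.pi) φJ ∧ |φ - φJ| ≤ η) ∧
  (∃ t ∈ Set.Icc (-(Real.pi / 2)) (Real.pi / 2),
    IsMinOn (fun θ' => quadForm A ((jacobiRotation l r θ' φ).col l))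
      (Set.Icc (-(Real.pi / 2)) (Real.pi / 2)) t ∧ |θ - foldAngle t| ≤ η)

/-! ### The modified algorithm -/

/-- The matrix `A_k = W_k* G W_k`. -/
def gramIterate {n : ℕ} (G : Matrix (Fin n) (Fin n) ℂ) (W : ℕ → Matrix (Fin n) (Fin n) ℂ) (k : ℕ) :
    Matrix (Fin n) (Fin n) ℂ := (W k)ᴴ * G * W k

/-- Column `i` won its comparison with column `j` in sweep number `q`: when the pair `{i, j}` was
about to be rotated, the diagonal entry with index `i` was the larger one. A tie is won by the
smaller index. -/
def Wins {n : ℕ} (G : Matrix (Fin n) (Fin n) ℂ) (W : ℕ → Matrix (Fin n) (Fin n) ℂ) (q : ℕ)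
    (i j : Fin n) : Prop :=
  ∃ k, q * sweepLength n ≤ k ∧ k < (q + 1) * sweepLength n ∧
    ((pivot n k = some (i, j) ∧ (gramIterate G W k j j).re ≤ (gramIterate G W k i i).re) ∨
     (pivot n k = some (j, i) ∧ (gramIterate G W k j j).re < (gramIterate G W k i i).re))

/-- The permutation `π` (column `i` becomes column `π i`) arranges the columns in decreasing order
according to the comparisons made in sweep `q`: if every column of a set `S` won against every
column outside `S`, then the columns of `S` come first. If the comparisons are transitive (that is,
consistent with a linear order), exactly one permutation has this property: the one which sorts the
columns by the comparisons. -/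
def IsSortingPerm {n : ℕ} (G : Matrix (Fin n) (Fin n) ℂ) (W : ℕ → Matrix (Fin n) (Fin n) ℂ)
    (q : ℕ) (π : Equiv.Perm (Fin n)) : Prop :=
  ∀ S : Set (Fin n), (∀ i ∈ S, ∀ j ∉ S, Wins G W q i j) → ∀ i ∈ S, ∀ j ∉ S, π i < π j

/-- `W` is the sequence of matrices produced by the modified algorithm for `G` with line searches
of accuracy `η`. It starts from the identity. At each stage the current matrix is multiplied by the
rotation with the angles returned by the line searches. If this was the last rotation of sweep `q`,
that is, if `k + 1 = (q + 1) m`, the columns are then permuted. -/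
def IsModifiedRun {n : ℕ} (G : Matrix (Fin n) (Fin n) ℂ) (η : ℝ)
    (W : ℕ → Matrix (Fin n) (Fin n) ℂ) : Prop :=
  W 0 = 1 ∧
  ∀ k, ∃ (l r : Fin n) (θ φ : ℝ), pivot n k = some (l, r) ∧
    IsLineSearchResult (gramIterate G W k) l r η θ φ ∧
    if sweepLength n ∣ k + 1 then
      ∃ π : Equiv.Perm (Fin n), IsSortingPerm G W (k / sweepLength n) π ∧
        ∀ i j, W (k + 1) i (π j) = (W k * jacobiRotation l r θ φ) i j
    else W (k + 1) = W k * jacobiRotation l r θ φ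

/-! ### The quantities of the convergence statement -/

/-- The Frobenius norm of the strictly upper triangular part of `A`. -/
def offNorm {n : ℕ} (A : Matrix (Fin n) (Fin n) ℂ) : ℝ :=
  √(∑ i, ∑ j, if i < j then ‖A i j‖ ^ 2 else 0)

/-- `P_k`, the Frobenius norm of the strictly upper triangular part of `A_k = W_k* G W_k`. -/
def P {n : ℕ} (G : Matrix (Fin n) (Fin n) ℂ) (W : ℕ → Matrix (Fin n) (Fin n) ℂ) (k : ℕ) : ℝ :=
  offNorm (gramIterate G W k)

/-- One third of the smallest distance between distinct eigenvalues of a Hermitian matrix. (The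
infimum is over a finite set, nonempty if the matrix has at least two distinct eigenvalues.) -/
def gapThird {n : ℕ} {G : Matrix (Fin n) (Fin n) ℂ} (hG : G.IsHermitian) : ℝ :=
  sInf {d : ℝ | ∃ i j, hG.eigenvalues i ≠ hG.eigenvalues j ∧
    d = |hG.eigenvalues i - hG.eigenvalues j|} / 3

/-- The operator norm of a square matrix with respect to the Euclidean norm. -/
def opNorm {n : ℕ} (G : Matrix (Fin n) (Fin n) ℂ) : ℝ :=
  ‖Matrix.toEuclideanCLM (n := Fin n) (𝕜 := ℂ) G‖

/-- The interference `‖H w_i‖` (Euclidean norm) inflicted by the `i`-th column `w_i` of `W`. -/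
def interference {nr nt : ℕ} (H : Matrix (Fin nr) (Fin nt) ℂ) (W : Matrix (Fin nt) (Fin nt) ℂ)
    (i : Fin nt) : ℝ := ‖WithLp.toLp 2 (H *ᵥ W.col i)‖

end OBNSLA

end

/-! Every $A_k$ is unitarily equivalent to $\mathrm{diag}(\lambda)$ with $0\le\lambda_q\le N=\|G\|$,
and distinct $\lambda_q$ are at least $3\delta$ apart. An exact line search would annihilate the
pivot entry. With accuracy $\eta$ its square is left at $O(\eta^2N^2)$
(`IsLineSearchResult.norm_rotate_sq_le`), while the off-diagonal mass outside the block is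
preserved. So noise adds up only linearly over a sweep.

While the off-diagonal part is small compared with $\delta$, each diagonal entry lies near exactly
one eigenvalue, and a single rotation cannot carry it to another (`IsSweep.near`). Hence the
assignment $\sigma$ of eigenvalues to positions is constant during a sweep, all comparisons between
different clusters come out right, and the sort makes $\sigma$ antitone
(`IsModifiedRun.exists_antitone_near`).

In the next sweep the clusters are therefore intervals of indices. Entries inside a cluster are
quadratically small for spectral reasons alone (`HasSpectrum.norm_apply_le_of_near`). For entries
between clusters, the sum of squares over pairs already visited is followed. A pivot across clusters
has an angle of order $R/\delta$, where $R$ bounds the off-diagonal size, and so disturbs old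
entries by $O(R^2/\delta)$. A pivot inside a cluster may have a large angle, but by
`visited_left_iff_visited_right` it only mixes visited entries with visited ones, which preserves
their sum of squares. This gives `IsSweep.offSq_sweepLength_le`.

For the interference, the squared moduli of the diagonalizing unitary form a doubly stochastic
matrix concentrated on matching eigenvalues, so $\sigma$ takes each eigenvalue with its multiplicity
(`HasSpectrum.card_near_eq`). Being antitone, it vanishes exactly on the last $n_t-n_r$ positions.
-/

namespace OBNSLA

open Matrix

/-! ### Plane rotations and invariant weighted sums of squares. -/

section Rotation

variable {n : ℕ}

/-- Right multiplication by a rotation mixes the columns `l` and `r` only. -/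
theorem mul_jacobiRotation_left {l r : Fin n} (h : l ≠ r) (θ φ : ℝ)
    (B : Matrix (Fin n) (Fin n) ℂ) (p : Fin n) :
    (B * jacobiRotation l r θ φ) p l
      = B p l * Real.cos θ + B p r * (Complex.exp (-(Complex.I * φ)) * Real.sin θ) := by
  rw [Matrix.mul_apply, ← Finset.sum_subset (Finset.subset_univ {l, r}), Finset.sum_pair h]
  · simp [jacobiRotation, h.symm]
  · intro x _ hx
    simp only [Finset.mem_insert, Finset.mem_singleton, not_or] at hx
    simp [jacobiRotation, hx.1, hx.2]

theorem mul_jacobiRotation_right {l r : Fin n} (h : l ≠ r) (θ φ : ℝ)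
    (B : Matrix (Fin n) (Fin n) ℂ) (p : Fin n) :
    (B * jacobiRotation l r θ φ) p r
      = -(B p l * (Complex.exp (Complex.I * φ) * Real.sin θ)) + B p r * Real.cos θ := by
  rw [Matrix.mul_apply, ← Finset.sum_subset (Finset.subset_univ {l, r}), Finset.sum_pair h]
  · simp [jacobiRotation, h]
  · intro x _ hx
    simp only [Finset.mem_insert, Finset.mem_singleton, not_or] at hx
    simp [jacobiRotation, hx.1, hx.2]

theorem mul_jacobiRotation_of_ne {l r q : Fin n} (hl : q ≠ l) (hr : q ≠ r) (θ φ : ℝ)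
    (B : Matrix (Fin n) (Fin n) ℂ) (p : Fin n) :
    (B * jacobiRotation l r θ φ) p q = B p q := by
  rw [Matrix.mul_apply, Finset.sum_eq_single q]
  · simp [jacobiRotation, hl, hr]
  · intro x _ hx
    simp [jacobiRotation, hl, hr, hx]
  · simp

theorem star_exp_I_mul (φ : ℝ) :
    star (Complex.exp (Complex.I * φ)) = Complex.exp (-(Complex.I * φ)) := by
  rw [Complex.star_def, ← Complex.exp_conj]
  simp

theorem star_exp_neg_I_mul (φ : ℝ) :
    star (Complex.exp (-(Complex.I * φ))) = Complex.exp (Complex.I * φ) := by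
  rw [Complex.star_def, ← Complex.exp_conj]
  simp

theorem exp_neg_I_mul_mul_exp (φ : ℝ) :
    Complex.exp (-(Complex.I * φ)) * Complex.exp (Complex.I * φ) = 1 := by
  rw [← Complex.exp_add]; simp

theorem ofReal_cos_sq_add_sin_sq (θ : ℝ) :
    (Real.cos θ : ℂ) ^ 2 + (Real.sin θ : ℂ) ^ 2 = 1 := by
  exact_mod_cast Real.cos_sq_add_sin_sq θ

theorem jacobiRotation_conjTranspose_mul_self {l r : Fin n} (h : l ≠ r) (θ φ : ℝ) :
    (jacobiRotation l r θ φ)ᴴ * jacobiRotation l r θ φ = 1 := by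
  have hcs := ofReal_cos_sq_add_sin_sq θ
  have he := exp_neg_I_mul_mul_exp φ
  have e1 := star_exp_I_mul φ
  have e2 := star_exp_neg_I_mul φ
  simp only [Complex.star_def] at e1 e2
  ext p q
  by_cases hql : q = l
  · subst hql
    rw [mul_jacobiRotation_left h]
    by_cases hpl : p = q
    · subst hpl
      simp only [conjTranspose_apply, jacobiRotation, of_apply, h.symm, h, if_true, if_false,
        Complex.star_def, map_mul, Complex.conj_ofReal, e2, true_or, true_and, and_true,
        one_apply_eq]
      linear_combination hcs + (Real.sin θ : ℂ) ^ 2 * he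
    · by_cases hpr : p = r
      · subst hpr
        simp only [conjTranspose_apply, jacobiRotation, of_apply, h.symm, h, if_true, if_false,
          Complex.star_def, map_mul, map_neg, Complex.conj_ofReal, e1, true_or, or_true, true_and,
          and_true, and_self, one_apply_ne h.symm]
        ring
      · simp [jacobiRotation, hpl, hpr, Ne.symm hpl, Ne.symm hpr]
  · by_cases hqr : q = r
    · subst hqr
      rw [mul_jacobiRotation_right h]
      by_cases hpl : p = l
      · subst hpl
        simp only [conjTranspose_apply, jacobiRotation, of_apply, h.symm, h, if_true, if_false,
          Complex.star_def, map_mul, Complex.conj_ofReal, e2, true_or, or_true, true_and,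
          and_true, and_self, one_apply_ne h]
        ring
      · by_cases hpr : p = q
        · subst hpr
          simp only [conjTranspose_apply, jacobiRotation, of_apply, h.symm, h, if_true, if_false,
            Complex.star_def, map_mul, map_neg, Complex.conj_ofReal, e1, true_or, or_true, true_and,
            and_true, and_self, one_apply_eq]
          linear_combination hcs + (Real.sin θ : ℂ) ^ 2 * he
        · simp [jacobiRotation, hpl, hpr, Ne.symm hpl, Ne.symm hpr]
    · rw [mul_jacobiRotation_of_ne hql hqr]
      by_cases hpq : p = q
      · subst hpq
        simp [jacobiRotation, hql, hqr]
      · simp [jacobiRotation, hpq, Ne.symm hpq, hql, hqr]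

theorem jacobiRotation_mul_conjTranspose_self {l r : Fin n} (h : l ≠ r) (θ φ : ℝ) :
    jacobiRotation l r θ φ * (jacobiRotation l r θ φ)ᴴ = 1 :=
  mul_eq_one_comm.mp (jacobiRotation_conjTranspose_mul_self h θ φ)

/-- The pairs of numbers arising from a plane rotation have the same sum of squares. -/
theorem norm_sq_add_norm_sq_rotation (x y : ℂ) (θ φ : ℝ) :
    ‖x * Real.cos θ + y * (Complex.exp (-(Complex.I * φ)) * Real.sin θ)‖ ^ 2
      + ‖-(x * (Complex.exp (Complex.I * φ) * Real.sin θ)) + y * Real.cos θ‖ ^ 2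
      = ‖x‖ ^ 2 + ‖y‖ ^ 2 := by
  have hcs := ofReal_cos_sq_add_sin_sq θ
  have he := exp_neg_I_mul_mul_exp φ
  have e1 := star_exp_I_mul φ
  have e2 := star_exp_neg_I_mul φ
  simp only [Complex.star_def] at e1 e2
  apply Complex.ofReal_injective
  push_cast
  simp only [← Complex.mul_conj', map_add, map_mul, map_neg, Complex.conj_ofReal, e1, e2,
    ← Complex.ofReal_cos, ← Complex.ofReal_sin]
  linear_combination (x * (starRingEnd ℂ) x + y * (starRingEnd ℂ) y) *
    (hcs + (Real.sin θ : ℂ) ^ 2 * he)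

/-- The sum of the squared moduli of the entries with weights `w`. -/
noncomputable def weightedSq (w : Fin n → Fin n → ℝ) (A : Matrix (Fin n) (Fin n) ℂ) : ℝ :=
  ∑ p, ∑ q, w p q * ‖A p q‖ ^ 2

theorem sum_eq_add_add_sum_ne {l r : Fin n} (h : l ≠ r) (f : Fin n → ℝ) :
    ∑ q, f q = f l + f r + ∑ q ∈ Finset.univ \ {l, r}, f q := by
  rw [← Finset.sum_pair h, add_comm, Finset.sum_sdiff (Finset.subset_univ _)]

/-- In each row the rotation acts unitarily on the two entries in columns `l` and `r`, which carry
the same weight. -/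
theorem weightedSq_mul_jacobiRotation {l r : Fin n} (h : l ≠ r) (θ φ : ℝ)
    {w : Fin n → Fin n → ℝ} (hw : ∀ p, w p l = w p r) (B : Matrix (Fin n) (Fin n) ℂ) :
    weightedSq w (B * jacobiRotation l r θ φ) = weightedSq w B := by
  refine Finset.sum_congr rfl fun p _ => ?_
  rw [sum_eq_add_add_sum_ne h, sum_eq_add_add_sum_ne h, mul_jacobiRotation_left h,
    mul_jacobiRotation_right h, ← hw p, ← mul_add, ← mul_add, norm_sq_add_norm_sq_rotation]
  congr 1
  refine Finset.sum_congr rfl fun q hq => ?_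
  simp only [Finset.mem_sdiff, Finset.mem_univ, true_and, Finset.mem_insert,
    Finset.mem_singleton, not_or] at hq
  rw [mul_jacobiRotation_of_ne hq.1 hq.2]

theorem weightedSq_conjTranspose (w : Fin n → Fin n → ℝ) (A : Matrix (Fin n) (Fin n) ℂ) :
    weightedSq w Aᴴ = weightedSq (fun p q => w q p) A := by
  unfold weightedSq
  rw [Finset.sum_comm]
  simp

/-- The unitary conjugate `R* B R` by a plane rotation. -/
noncomputable def rotate (l r : Fin n) (θ φ : ℝ) (B : Matrix (Fin n) (Fin n) ℂ) : Matrix (Fin n) (Fin n) ℂ :=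
  (jacobiRotation l r θ φ)ᴴ * B * jacobiRotation l r θ φ

theorem rotate_isHermitian {l r : Fin n} {θ φ : ℝ} {B : Matrix (Fin n) (Fin n) ℂ}
    (hB : B.IsHermitian) : (rotate l r θ φ B).IsHermitian :=
  isHermitian_conjTranspose_mul_mul _ hB

/-- A weighted sum of squares is invariant under a rotation if the weights do not distinguish
the two coordinates which are rotated. -/
theorem weightedSq_rotate {l r : Fin n} (h : l ≠ r) (θ φ : ℝ)
    {w : Fin n → Fin n → ℝ} (hw : ∀ p, w p l = w p r) (hw' : ∀ p, w l p = w r p)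
    (B : Matrix (Fin n) (Fin n) ℂ) :
    weightedSq w (rotate l r θ φ B) = weightedSq w B := by
  rw [rotate, weightedSq_mul_jacobiRotation h _ _ hw]
  have : (jacobiRotation l r θ φ)ᴴ * B = (Bᴴ * jacobiRotation l r θ φ)ᴴ := by
    simp
  rw [this, weightedSq_conjTranspose, weightedSq_mul_jacobiRotation h _ _ hw',
    weightedSq_conjTranspose]

theorem conjTranspose_jacobiRotation_mul_apply (l r : Fin n) (θ φ : ℝ)
    (B : Matrix (Fin n) (Fin n) ℂ) (p q : Fin n) :
    ((jacobiRotation l r θ φ)ᴴ * B) p q = star ((Bᴴ * jacobiRotation l r θ φ) q p) := by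
  have : (jacobiRotation l r θ φ)ᴴ * B = (Bᴴ * jacobiRotation l r θ φ)ᴴ := by simp
  rw [this, conjTranspose_apply]

theorem rotate_apply_of_ne {l r p q : Fin n} (hpl : p ≠ l) (hpr : p ≠ r) (hql : q ≠ l)
    (hqr : q ≠ r) (θ φ : ℝ) (B : Matrix (Fin n) (Fin n) ℂ) :
    rotate l r θ φ B p q = B p q := by
  rw [rotate, mul_jacobiRotation_of_ne hql hqr, conjTranspose_jacobiRotation_mul_apply,
    mul_jacobiRotation_of_ne hpl hpr]
  simp

theorem rotate_apply_left {l r p : Fin n} (h : l ≠ r) (hpl : p ≠ l) (hpr : p ≠ r) (θ φ : ℝ)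
    (B : Matrix (Fin n) (Fin n) ℂ) :
    rotate l r θ φ B p l
      = B p l * Real.cos θ + B p r * (Complex.exp (-(Complex.I * φ)) * Real.sin θ) := by
  rw [rotate, mul_jacobiRotation_left h, conjTranspose_jacobiRotation_mul_apply,
    conjTranspose_jacobiRotation_mul_apply, mul_jacobiRotation_of_ne hpl hpr,
    mul_jacobiRotation_of_ne hpl hpr]
  simp

theorem rotate_apply_right {l r p : Fin n} (h : l ≠ r) (hpl : p ≠ l) (hpr : p ≠ r) (θ φ : ℝ)
    (B : Matrix (Fin n) (Fin n) ℂ) :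
    rotate l r θ φ B p r
      = -(B p l * (Complex.exp (Complex.I * φ) * Real.sin θ)) + B p r * Real.cos θ := by
  rw [rotate, mul_jacobiRotation_right h, conjTranspose_jacobiRotation_mul_apply,
    conjTranspose_jacobiRotation_mul_apply, mul_jacobiRotation_of_ne hpl hpr,
    mul_jacobiRotation_of_ne hpl hpr]
  simp

theorem norm_exp_I_mul (φ : ℝ) : ‖Complex.exp (Complex.I * φ)‖ = 1 := by
  rw [mul_comm]; exact Complex.norm_exp_ofReal_mul_I φ

theorem norm_exp_neg_I_mul (φ : ℝ) : ‖Complex.exp (-(Complex.I * φ))‖ = 1 := by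
  rw [← star_exp_I_mul, norm_star, norm_exp_I_mul]

/-- A rotation by a small angle changes the entries outside the rotated block by little. -/
theorem norm_rotate_apply_le {l r : Fin n} (h : l ≠ r) (θ φ : ℝ)
    {B : Matrix (Fin n) (Fin n) ℂ} (hB : B.IsHermitian) {M : ℝ} (hM : 0 ≤ M)
    (hoff : ∀ i j, i ≠ j → ‖B i j‖ ≤ M)
    (p q : Fin n) (hpq : ¬ ((p = l ∨ p = r) ∧ (q = l ∨ q = r))) :
    ‖rotate l r θ φ B p q‖ ≤ ‖B p q‖ + |Real.sin θ| * M := by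
  have hc : ‖(Real.cos θ : ℂ)‖ ≤ 1 := by
    rw [Complex.norm_real]; exact Real.abs_cos_le_one θ
  have hs : ‖(Real.sin θ : ℂ)‖ = |Real.sin θ| := by rw [Complex.norm_real]; rfl
  have hs0 := abs_nonneg (Real.sin θ)
  have key : ∀ p q, p ≠ l → p ≠ r →
      ‖rotate l r θ φ B p q‖ ≤ ‖B p q‖ + |Real.sin θ| * M := by
    intro p q hpl hpr
    by_cases hql : q = l
    · subst hql
      rw [rotate_apply_left h hpl hpr]
      refine (norm_add_le _ _).trans ?_
      rw [norm_mul, norm_mul, norm_mul, norm_exp_neg_I_mul, hs, one_mul, mul_comm ‖B p r‖]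
      have := hoff p r hpr
      gcongr
      exact mul_le_of_le_one_right (norm_nonneg _) hc
    · by_cases hqr : q = r
      · subst hqr
        rw [rotate_apply_right h hpl hpr, add_comm ‖B p q‖]
        refine (norm_add_le _ _).trans ?_
        rw [norm_neg, norm_mul, norm_mul, norm_mul, norm_exp_I_mul, hs, one_mul, mul_comm ‖B p l‖]
        have := hoff p l hpl
        gcongr
        exact mul_le_of_le_one_right (norm_nonneg _) hc
      · rw [rotate_apply_of_ne hpl hpr hql hqr]
        have := mul_nonneg hs0 hM
        linarith
  -- If `p` lies in the block then `q` does not, and Hermitian symmetry exchanges their roles.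
  by_cases hp : p = l ∨ p = r
  · have hq : ¬ (q = l ∨ q = r) := fun hq => hpq ⟨hp, hq⟩
    rw [not_or] at hq
    have h1 := key q p hq.1 hq.2
    rwa [← (rotate_isHermitian hB).apply, norm_star, ← hB.apply p q, norm_star]
  · rw [not_or] at hp
    exact key p q hp.1 hp.2

end Rotation

/-! ### The rotated 2×2 block in terms of the double angle. -/

section Block

variable {n : ℕ}

/-- Half the difference of the diagonal entries of the block `(l, r)`. -/
noncomputable def halfDiff (A : Matrix (Fin n) (Fin n) ℂ) (l r : Fin n) : ℝ :=
  ((A l l).re - (A r r).re) / 2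

/-- The entry `(l, r)`, turned by the angle `-φ`. -/
noncomputable def turnedEntry (A : Matrix (Fin n) (Fin n) ℂ) (l r : Fin n) (φ : ℝ) : ℂ :=
  A l r * Complex.exp (-(Complex.I * φ))

theorem norm_turnedEntry (A : Matrix (Fin n) (Fin n) ℂ) (l r : Fin n) (φ : ℝ) :
    ‖turnedEntry A l r φ‖ = ‖A l r‖ := by
  rw [turnedEntry, norm_mul, norm_exp_neg_I_mul, mul_one]

theorem apply_eq_turnedEntry_mul (A : Matrix (Fin n) (Fin n) ℂ) (l r : Fin n) (φ : ℝ) :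
    A l r = turnedEntry A l r φ * Complex.exp (Complex.I * φ) := by
  rw [turnedEntry, mul_assoc, exp_neg_I_mul_mul_exp, mul_one]

theorem apply_swap_eq_star_turnedEntry_mul {A : Matrix (Fin n) (Fin n) ℂ} (hA : A.IsHermitian)
    (l r : Fin n) (φ : ℝ) :
    A r l = star (turnedEntry A l r φ) * Complex.exp (-(Complex.I * φ)) := by
  rw [← hA.apply r l, apply_eq_turnedEntry_mul A l r φ, star_mul, star_exp_I_mul, mul_comm]

theorem apply_self_eq_re {A : Matrix (Fin n) (Fin n) ℂ} (hA : A.IsHermitian) (i : Fin n) :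
    A i i = ((A i i).re : ℂ) :=
  (hA.coe_re_apply_self i).symm

theorem rotate_left_left {A : Matrix (Fin n) (Fin n) ℂ} (hA : A.IsHermitian) {l r : Fin n}
    (h : l ≠ r) (θ φ : ℝ) :
    (rotate l r θ φ A l l).re = ((A l l).re + (A r r).re) / 2
      + (halfDiff A l r * Real.cos (2 * θ) + (turnedEntry A l r φ).re * Real.sin (2 * θ)) := by
  have e1 := star_exp_I_mul φ
  have e2 := star_exp_neg_I_mul φ
  have he := exp_neg_I_mul_mul_exp φ
  have hcs := Real.cos_sq_add_sin_sq θ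
  simp only [Complex.star_def] at e1 e2
  have hc : rotate l r θ φ A l l = (((A l l).re * Real.cos θ ^ 2 + (A r r).re * Real.sin θ ^ 2
      + 2 * (turnedEntry A l r φ).re * Real.sin θ * Real.cos θ : ℝ) : ℂ) := by
    rw [rotate, mul_jacobiRotation_left h, conjTranspose_jacobiRotation_mul_apply,
      conjTranspose_jacobiRotation_mul_apply, mul_jacobiRotation_left h, mul_jacobiRotation_left h,
      hA.eq, apply_eq_turnedEntry_mul A l r φ, apply_swap_eq_star_turnedEntry_mul hA l r φ,
      apply_self_eq_re hA l, apply_self_eq_re hA r]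
    have hz := Complex.add_conj (turnedEntry A l r φ)
    simp only [Complex.star_def, map_add, map_mul, Complex.conj_ofReal, e1, e2, Complex.conj_conj,
      Complex.ofReal_re]
    push_cast at hz ⊢
    linear_combination ((A r r).re * Complex.sin θ ^ 2 + Complex.sin θ * Complex.cos θ *
      (turnedEntry A l r φ + (starRingEnd ℂ) (turnedEntry A l r φ))) * he
      + Complex.sin θ * Complex.cos θ * hz
  rw [hc, Complex.ofReal_re, halfDiff, Real.cos_two_mul, Real.sin_two_mul]
  linear_combination (A r r).re * hcs

theorem rotate_right_right {A : Matrix (Fin n) (Fin n) ℂ} (hA : A.IsHermitian) {l r : Fin n}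
    (h : l ≠ r) (θ φ : ℝ) :
    (rotate l r θ φ A r r).re = ((A l l).re + (A r r).re) / 2
      - (halfDiff A l r * Real.cos (2 * θ) + (turnedEntry A l r φ).re * Real.sin (2 * θ)) := by
  have e1 := star_exp_I_mul φ
  have e2 := star_exp_neg_I_mul φ
  have he := exp_neg_I_mul_mul_exp φ
  have hcs := Real.cos_sq_add_sin_sq θ
  simp only [Complex.star_def] at e1 e2
  have hc : rotate l r θ φ A r r = (((A l l).re * Real.sin θ ^ 2 + (A r r).re * Real.cos θ ^ 2
      - 2 * (turnedEntry A l r φ).re * Real.sin θ * Real.cos θ : ℝ) : ℂ) := by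
    rw [rotate, mul_jacobiRotation_right h, conjTranspose_jacobiRotation_mul_apply,
      conjTranspose_jacobiRotation_mul_apply, mul_jacobiRotation_right h,
      mul_jacobiRotation_right h,
      hA.eq, apply_eq_turnedEntry_mul A l r φ, apply_swap_eq_star_turnedEntry_mul hA l r φ,
      apply_self_eq_re hA l, apply_self_eq_re hA r]
    have hz := Complex.add_conj (turnedEntry A l r φ)
    simp only [Complex.star_def, map_add, map_mul, map_neg, Complex.conj_ofReal, e1, e2,
      Complex.conj_conj, Complex.ofReal_re]
    push_cast at hz ⊢
    linear_combination ((A l l).re * Complex.sin θ ^ 2 - Complex.sin θ * Complex.cos θ *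
      (turnedEntry A l r φ + (starRingEnd ℂ) (turnedEntry A l r φ))) * he
      - Complex.sin θ * Complex.cos θ * hz
  rw [hc, Complex.ofReal_re, halfDiff, Real.cos_two_mul, Real.sin_two_mul]
  linear_combination (A l l).re * hcs

/-- The first square is that of the derivative, with respect to `2 * θ`, of the oscillating part of
the diagonal entry. A critical inner angle thus annihilates it; the imaginary part is controlled
only by the phase `φ`. -/
theorem norm_rotate_left_right_sq {A : Matrix (Fin n) (Fin n) ℂ} (hA : A.IsHermitian)
    {l r : Fin n} (h : l ≠ r) (θ φ : ℝ) :
    ‖rotate l r θ φ A l r‖ ^ 2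
      = ((turnedEntry A l r φ).re * Real.cos (2 * θ) - halfDiff A l r * Real.sin (2 * θ)) ^ 2
        + (turnedEntry A l r φ).im ^ 2 := by
  have e1 := star_exp_I_mul φ
  have e2 := star_exp_neg_I_mul φ
  have he := exp_neg_I_mul_mul_exp φ
  have hcs := ofReal_cos_sq_add_sin_sq θ
  simp only [Complex.star_def] at e1 e2
  have hc : rotate l r θ φ A l r = Complex.exp (Complex.I * φ) *
      (((turnedEntry A l r φ).re * Real.cos (2 * θ) - halfDiff A l r * Real.sin (2 * θ) : ℝ)
        + ((turnedEntry A l r φ).im : ℝ) * Complex.I) := by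
    rw [rotate, mul_jacobiRotation_right h, conjTranspose_jacobiRotation_mul_apply,
      conjTranspose_jacobiRotation_mul_apply, mul_jacobiRotation_left h, mul_jacobiRotation_left h,
      hA.eq, apply_eq_turnedEntry_mul A l r φ, apply_swap_eq_star_turnedEntry_mul hA l r φ,
      apply_self_eq_re hA l, apply_self_eq_re hA r, Real.cos_two_mul, Real.sin_two_mul,
      halfDiff]
    have hz' : (starRingEnd ℂ) (turnedEntry A l r φ)
        = (turnedEntry A l r φ).re - (turnedEntry A l r φ).im * Complex.I := by
      apply Complex.ext <;> simp
    simp only [Complex.star_def, map_add, map_sub, map_mul, Complex.conj_ofReal, Complex.conj_I, e1,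
      e2, hz']
    generalize (turnedEntry A l r φ).re = x
    generalize (turnedEntry A l r φ).im = y
    push_cast at hcs ⊢
    generalize Complex.exp (Complex.I * φ) = e at he ⊢
    generalize Complex.exp (-(Complex.I * φ)) = e' at he ⊢
    generalize Complex.cos (θ : ℂ) = c at hcs ⊢
    generalize Complex.sin (θ : ℂ) = s at hcs ⊢
    linear_combination (-(s ^ 2 * (x - y * Complex.I) * e)) * he + e * (y * Complex.I - x) * hcs
  rw [hc, norm_mul, norm_exp_I_mul, one_mul, Complex.sq_norm, Complex.normSq_add_mul_I]

theorem quadForm_jacobiRotation_col (A : Matrix (Fin n) (Fin n) ℂ) (l r : Fin n) (θ φ : ℝ) :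
    quadForm A ((jacobiRotation l r θ φ).col l) = (rotate l r θ φ A l l).re := by
  rw [quadForm, rotate, Matrix.mul_assoc, Matrix.mul_apply]
  rfl

end Block

/-! ### What the two line searches guarantee. -/

section LineSearch

variable {n : ℕ} {A : Matrix (Fin n) (Fin n) ℂ} {l r : Fin n} {η θ φ : ℝ}

/-- At inner angle π/4 the quadratic form is the mean of the two diagonal entries plus the real part
of the turned entry, so this phase is the ideal outcome of the first search. -/
theorem exists_turnedEntry_eq_neg_norm (A : Matrix (Fin n) (Fin n) ℂ) (l r : Fin n) :
    ∃ φ ∈ Set.Icc (-Real.pi) Real.pi, turnedEntry A l r φ = -(‖A l r‖ : ℂ) := by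
  refine ⟨Complex.arg (-(A l r)), ⟨(Complex.neg_pi_lt_arg _).le, Complex.arg_le_pi _⟩, ?_⟩
  have h := Complex.norm_mul_exp_arg_mul_I (-(A l r))
  rw [norm_neg, mul_comm _ Complex.I] at h
  have h2 : A l r = -(‖A l r‖ * Complex.exp (Complex.I * (Complex.arg (-(A l r))))) := by
    rw [h, neg_neg]
  have he := exp_neg_I_mul_mul_exp (Complex.arg (-(A l r)))
  generalize Complex.arg (-(A l r)) = ψ at h2 he ⊢
  rw [turnedEntry]
  linear_combination Complex.exp (-(Complex.I * ψ)) * h2 - (‖A l r‖ : ℂ) * he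

/-- The accuracy of the first line search bounds the imaginary part of the turned entry. -/
theorem IsLineSearchResult.abs_im_turnedEntry_le (hA : A.IsHermitian) (h : l ≠ r)
    (hs : IsLineSearchResult A l r η θ φ) :
    |(turnedEntry A l r φ).im| ≤ η * ‖A l r‖ := by
  obtain ⟨⟨ψ, -, hmin, hψ⟩, -⟩ := hs
  obtain ⟨φ₀, hφ₀, h₀⟩ := exists_turnedEntry_eq_neg_norm A l r
  have h1 := hmin hφ₀
  have h2 : (2 : ℝ) * (Real.pi / 4) = Real.pi / 2 := by ring
  simp only [Set.mem_ofPred_eq, quadForm_jacobiRotation_col, rotate_left_left hA h, h2,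
    Real.cos_pi_div_two, Real.sin_pi_div_two, h₀] at h1
  -- The turned entry has modulus `‖A l r‖` for every phase, so a real part this small forces it to
  -- be `-‖A l r‖`. The returned phase differs from `ψ` by at most `η`, which creates the imaginary
  -- part.
  have h3 : (turnedEntry A l r ψ).re ≤ -‖A l r‖ := by
    have : (-(‖A l r‖ : ℂ)).re = -‖A l r‖ := by simp
    rw [this] at h1
    linarith
  have h4 : turnedEntry A l r ψ = -(‖A l r‖ : ℂ) := by
    have h5 := Complex.sq_norm (turnedEntry A l r ψ)
    rw [norm_turnedEntry, Complex.normSq_apply] at h5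
    have h6 : (turnedEntry A l r ψ).im = 0 := by
      have := norm_nonneg (A l r)
      have h7 : (turnedEntry A l r ψ).im * (turnedEntry A l r ψ).im ≤ 0 := by nlinarith
      exact mul_self_eq_zero.mp (le_antisymm h7 (mul_self_nonneg _))
    have h7 : (turnedEntry A l r ψ).re = -‖A l r‖ := by
      have := Complex.abs_re_le_norm (turnedEntry A l r ψ)
      rw [norm_turnedEntry] at this
      exact le_antisymm h3 (abs_le.mp this).1
    apply Complex.ext <;> simp [h6, h7]
  have h5 : turnedEntry A l r φ = -(‖A l r‖ : ℂ) * Complex.exp (-(Complex.I * (φ - ψ : ℝ))) := by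
    rw [← h4, turnedEntry, turnedEntry, mul_assoc, ← Complex.exp_add]
    push_cast
    ring_nf
  have h6 : (turnedEntry A l r φ).im = ‖A l r‖ * Real.sin (φ - ψ) := by
    have : -(Complex.I * ((φ - ψ : ℝ) : ℂ)) = ((-(φ - ψ) : ℝ) : ℂ) * Complex.I := by
      push_cast; ring
    rw [h5, this, ← Complex.ofReal_neg, Complex.re_ofReal_mul |> fun _ => Complex.im_ofReal_mul,
      Complex.exp_ofReal_mul_I_im, Real.sin_neg]
    ring
  rw [h6, abs_mul, abs_norm, mul_comm]
  exact mul_le_mul_of_nonneg_right ((Real.abs_sin_le_abs).trans hψ) (norm_nonneg _)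

/-- The minimizer of `D cos 2t + x sin 2t` over `[-π/2, π/2]` is a critical point. -/
theorem critical_of_isMinOn {D x t : ℝ}
    (hmin : ∀ u ∈ Set.Icc (-(Real.pi / 2)) (Real.pi / 2),
      D * Real.cos (2 * t) + x * Real.sin (2 * t) ≤ D * Real.cos (2 * u) + x * Real.sin (2 * u)) :
    x * Real.cos (2 * t) - D * Real.sin (2 * t) = 0 := by
  -- Half the argument of `w` lies in the search interval and attains the global minimum `-‖w‖`.
  -- Value and derivative have squares adding up to `‖w‖ ^ 2`, so the derivative vanishes at `t`,
  -- even at an endpoint.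
  set w : ℂ := ⟨-D, -x⟩ with hw
  have h1 := hmin (w.arg / 2) ⟨by linarith [Complex.neg_pi_lt_arg w], by
    linarith [Complex.arg_le_pi w]⟩
  rw [mul_div_cancel₀ _ (two_ne_zero' ℝ)] at h1
  have hc := Complex.norm_mul_cos_arg w
  have hs := Complex.norm_mul_sin_arg w
  have hn := Complex.sq_norm w
  rw [Complex.normSq_apply] at hn
  simp only [hw] at hc hs hn
  rw [← hw] at hc hs hn
  have hcs := Real.sin_sq_add_cos_sq (2 * t)
  have hcs' := Real.sin_sq_add_cos_sq w.arg
  have h2 : D * Real.cos w.arg + x * Real.sin w.arg = -‖w‖ := by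
    have hD : D = -(‖w‖ * Real.cos w.arg) := by linarith
    have hx : x = -(‖w‖ * Real.sin w.arg) := by linarith
    conv_lhs => rw [hD, hx]
    linear_combination (-‖w‖) * hcs'
  have hn0 := norm_nonneg w
  have h3 : (x * Real.cos (2 * t) - D * Real.sin (2 * t)) ^ 2
      + (D * Real.cos (2 * t) + x * Real.sin (2 * t)) ^ 2 = ‖w‖ ^ 2 := by
    rw [hn]
    linear_combination (D ^ 2 + x ^ 2) * hcs
  have h4 : ‖w‖ ^ 2 ≤ (D * Real.cos (2 * t) + x * Real.sin (2 * t)) ^ 2 := by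
    rw [h2] at h1
    nlinarith
  have h5 : (x * Real.cos (2 * t) - D * Real.sin (2 * t)) ^ 2 ≤ 0 := by linarith
  exact pow_eq_zero_iff (two_ne_zero) |>.mp (le_antisymm h5 (sq_nonneg _))

theorem abs_foldAngle_le {t : ℝ} (ht : t ∈ Set.Icc (-(Real.pi / 2)) (Real.pi / 2)) :
    |foldAngle t| ≤ Real.pi / 4 := by
  have hpi := Real.pi_pos
  obtain ⟨h1, h2⟩ := ht
  rw [foldAngle, abs_le]
  split_ifs with h3 h4
  · exact h3
  · rw [not_and_or, not_le, not_le] at h3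
    constructor <;> rcases h3 with h3 | h3 <;> linarith
  · rw [not_and_or, not_le, not_le] at h3
    constructor <;> rcases h3 with h3 | h3 <;> linarith

/-- Shifting by π/2 flips the sign of both terms. A minimum may become a maximum, but the pivot
entry is annihilated all the same. -/
theorem critical_foldAngle {D x t : ℝ}
    (h : x * Real.cos (2 * t) - D * Real.sin (2 * t) = 0) :
    x * Real.cos (2 * foldAngle t) - D * Real.sin (2 * foldAngle t) = 0 := by
  rw [foldAngle]
  split_ifs with h3 h4
  · exact h
  · have : 2 * (t - 1 * (Real.pi / 2)) = 2 * t - Real.pi := by ring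
    rw [this, Real.cos_sub_pi, Real.sin_sub_pi]
    linarith
  · have : 2 * (t - -1 * (Real.pi / 2)) = 2 * t + Real.pi := by ring
    rw [this, Real.cos_add_pi, Real.sin_add_pi]
    linarith

/-- The second line search returns, up to `η`, the inner angle which annihilates the real part
of the turned entry. -/
theorem IsLineSearchResult.exists_critical (hA : A.IsHermitian) (h : l ≠ r)
    (hs : IsLineSearchResult A l r η θ φ) :
    ∃ T, |T| ≤ Real.pi / 4 ∧ |θ - T| ≤ η ∧
      (turnedEntry A l r φ).re * Real.cos (2 * T) - halfDiff A l r * Real.sin (2 * T) = 0 := by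
  obtain ⟨-, t, ht, hmin, hθ⟩ := hs
  refine ⟨foldAngle t, abs_foldAngle_le ht, hθ, critical_foldAngle (critical_of_isMinOn ?_)⟩
  intro u hu
  have h1 := hmin hu
  simp only [Set.mem_ofPred_eq, quadForm_jacobiRotation_col, rotate_left_left hA h] at h1
  linarith

end LineSearch

/-! ### Quantitative effect of one inexact rotation. -/

section StepBounds

variable {n : ℕ} {A : Matrix (Fin n) (Fin n) ℂ} {l r : Fin n} {η θ φ N : ℝ}

theorem turnedEntry_re_sq_add_im_sq (A : Matrix (Fin n) (Fin n) ℂ) (l r : Fin n) (φ : ℝ) :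
    (turnedEntry A l r φ).re ^ 2 + (turnedEntry A l r φ).im ^ 2 = ‖A l r‖ ^ 2 := by
  rw [← norm_turnedEntry A l r φ, Complex.sq_norm, Complex.normSq_apply]
  ring

theorem abs_turnedEntry_re_le (A : Matrix (Fin n) (Fin n) ℂ) (l r : Fin n) (φ : ℝ) :
    |(turnedEntry A l r φ).re| ≤ ‖A l r‖ := by
  rw [← norm_turnedEntry A l r φ]; exact Complex.abs_re_le_norm _

/-- The pivot entry after the rotation is of the order of the accuracy. -/
theorem IsLineSearchResult.norm_rotate_sq_le (hA : A.IsHermitian) (h : l ≠ r)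
    (hblock : halfDiff A l r ^ 2 + ‖A l r‖ ^ 2 ≤ N ^ 2 / 4)
    (hs : IsLineSearchResult A l r η θ φ) :
    ‖rotate l r θ φ A l r‖ ^ 2 ≤ 5 / 4 * (η ^ 2 * N ^ 2) := by
  obtain ⟨T, -, hθ, hcrit⟩ := hs.exists_critical hA h
  have him := hs.abs_im_turnedEntry_le hA h
  have hz := turnedEntry_re_sq_add_im_sq A l r φ
  rw [norm_rotate_left_right_sq hA h]
  generalize (turnedEntry A l r φ).re = x at *
  generalize (turnedEntry A l r φ).im = y at *
  generalize halfDiff A l r = D at *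
  have hθT : 2 * θ = 2 * T + 2 * (θ - T) := by ring
  -- Relative to the critical angle only the sine of the angular error survives. It contributes `4 *
  -- η ^ 2 * (D ^ 2 + x ^ 2)`; with `y ^ 2 ≤ η ^ 2 * ‖A l r‖ ^ 2` and the block bound this gives the
  -- factor `5 / 4`.
  have h1 : x * Real.cos (2 * θ) - D * Real.sin (2 * θ)
      = -(Real.sin (2 * (θ - T)) * (D * Real.cos (2 * T) + x * Real.sin (2 * T))) := by
    rw [hθT, Real.cos_add, Real.sin_add]
    linear_combination Real.cos (2 * (θ - T)) * hcrit
  have h2 : (D * Real.cos (2 * T) + x * Real.sin (2 * T)) ^ 2 ≤ D ^ 2 + x ^ 2 := by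
    have := Real.sin_sq_add_cos_sq (2 * T)
    nlinarith [sq_nonneg (x * Real.cos (2 * T) - D * Real.sin (2 * T))]
  have h3 : Real.sin (2 * (θ - T)) ^ 2 ≤ 4 * η ^ 2 := by
    have h4 := (Real.abs_sin_le_abs (x := 2 * (θ - T)))
    rw [abs_mul, abs_two] at h4
    have h5 : |Real.sin (2 * (θ - T))| ^ 2 ≤ (2 * η) ^ 2 :=
      pow_le_pow_left₀ (abs_nonneg _) (by linarith) 2
    rw [sq_abs] at h5
    linarith
  have h4 : y ^ 2 ≤ η ^ 2 * ‖A l r‖ ^ 2 := by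
    have := pow_le_pow_left₀ (abs_nonneg _) him 2
    rwa [sq_abs, mul_pow] at this
  rw [h1, neg_sq, mul_pow]
  have h5 := mul_le_mul h3 h2 (sq_nonneg _) (by positivity)
  have hη := sq_nonneg η
  have h6 := mul_le_mul_of_nonneg_left hblock hη
  nlinarith [mul_nonneg hη (sq_nonneg y), mul_nonneg hη (sq_nonneg D)]

/-- The diagonal entries move by no more than the pivot entry and the accuracy. -/
theorem IsLineSearchResult.abs_rotate_diag_sub_le (hA : A.IsHermitian) (h : l ≠ r)
    (hN : 0 ≤ N) (hblock : halfDiff A l r ^ 2 + ‖A l r‖ ^ 2 ≤ N ^ 2 / 4)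
    (hs : IsLineSearchResult A l r η θ φ) (i : Fin n) :
    |(rotate l r θ φ A i i).re - (A i i).re| ≤ 2 * ‖A l r‖ + η * N := by
  obtain ⟨T, hT, hθ, hcrit⟩ := hs.exists_critical hA h
  have hη : 0 ≤ η := (abs_nonneg _).trans hθ
  have key : |halfDiff A l r * Real.cos (2 * θ) + (turnedEntry A l r φ).re * Real.sin (2 * θ)
      - halfDiff A l r| ≤ 2 * ‖A l r‖ + η * N := by
    have hx := abs_turnedEntry_re_le A l r φ
    have hz := turnedEntry_re_sq_add_im_sq A l r φ
    generalize (turnedEntry A l r φ).re = x at *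
    generalize (turnedEntry A l r φ).im = y at *
    generalize halfDiff A l r = D at *
    have hθT : 2 * θ = 2 * T + 2 * (θ - T) := by ring
    have hcs := Real.sin_sq_add_cos_sq (2 * T)
    have hcT : 0 ≤ Real.cos (2 * T) := by
      rw [abs_le] at hT
      apply Real.cos_nonneg_of_neg_pi_div_two_le_of_le <;> linarith
    have h1 : D * Real.cos (2 * θ) + x * Real.sin (2 * θ) - D
        = -(1 - Real.cos (2 * (θ - T))) * (D * Real.cos (2 * T) + x * Real.sin (2 * T))
          - D * (1 - Real.cos (2 * T)) + x * Real.sin (2 * T) := by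
      rw [hθT, Real.cos_add, Real.sin_add]
      linear_combination Real.sin (2 * (θ - T)) * hcrit
    have h2 : |D * Real.cos (2 * T) + x * Real.sin (2 * T)| ≤ N / 2 := by
      refine abs_le_of_sq_le_sq ?_ (by linarith)
      nlinarith [sq_nonneg (x * Real.cos (2 * T) - D * Real.sin (2 * T)), sq_nonneg y]
    have h3 : |1 - Real.cos (2 * (θ - T))| ≤ 2 * η := by
      have hs1 := Real.sin_sq_add_cos_sq (θ - T)
      have : 1 - Real.cos (2 * (θ - T)) = 2 * Real.sin (θ - T) ^ 2 := by
        rw [Real.cos_two_mul]; linarith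
      rw [this, abs_of_nonneg (by positivity), ← sq_abs]
      have h4 := Real.abs_sin_le_abs (x := θ - T)
      have h5 := Real.abs_sin_le_one (θ - T)
      nlinarith [abs_nonneg (Real.sin (θ - T))]
    -- Since `|T| ≤ π/4` makes `cos (2 * T)` nonnegative, `1 - cos` is at most `|sin|`; criticality
    -- turns `D * sin (2 * T)` into `x * cos (2 * T)`.
    have h4 : |D * (1 - Real.cos (2 * T))| ≤ |x| := by
      refine sq_le_sq.mp ?_
      have h5 : (D * Real.sin (2 * T)) ^ 2 = (x * Real.cos (2 * T)) ^ 2 := by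
        rw [sub_eq_zero.mp hcrit]
      have h6 : (1 - Real.cos (2 * T)) ^ 2 ≤ Real.sin (2 * T) ^ 2 := by
        nlinarith [Real.cos_le_one (2 * T)]
      have h7 := mul_le_mul_of_nonneg_left h6 (sq_nonneg D)
      nlinarith [mul_nonneg (sq_nonneg x) (sq_nonneg (Real.sin (2 * T)))]
    have h5 : |x * Real.sin (2 * T)| ≤ |x| := by
      rw [abs_mul]
      exact mul_le_of_le_one_right (abs_nonneg _) (Real.abs_sin_le_one _)
    have h6 : |-(1 - Real.cos (2 * (θ - T))) * (D * Real.cos (2 * T) + x * Real.sin (2 * T))|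
        ≤ η * N := by
      rw [abs_mul, abs_neg]
      calc _ ≤ (2 * η) * (N / 2) := mul_le_mul h3 h2 (abs_nonneg _) (by linarith)
        _ = η * N := by ring
    rw [h1]
    rw [abs_le] at h4 h5 h6 ⊢
    constructor <;> linarith [h4.1, h4.2, h5.1, h5.2, h6.1, h6.2]
  by_cases hil : i = l
  · subst hil
    rw [rotate_left_left hA h]
    convert key using 2
    rw [halfDiff]; ring
  · by_cases hir : i = r
    · subst hir
      rw [rotate_right_right hA h, ← abs_neg]
      convert key using 2
      rw [halfDiff]; ring
    · rw [rotate_apply_of_ne hil hir hil hir, sub_self, abs_zero]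
      have := norm_nonneg (A l r)
      positivity

/-- The rotation angle is small if the diagonal entries are separated. -/
theorem IsLineSearchResult.abs_sin_le_div_add (hA : A.IsHermitian) (h : l ≠ r)
    (hs : IsLineSearchResult A l r η θ φ) {d : ℝ} (hd : 0 < d) (hD : d ≤ |halfDiff A l r|) :
    |Real.sin θ| ≤ ‖A l r‖ / d + η := by
  obtain ⟨T, hT, hθ, hcrit⟩ := hs.exists_critical hA h
  have hx := abs_turnedEntry_re_le A l r φ
  generalize (turnedEntry A l r φ).re = x at *
  generalize halfDiff A l r = D at *
  have hcT : 1 / 2 ≤ Real.cos T := by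
    rw [← Real.cos_pi_div_three, ← Real.cos_abs T]
    apply Real.cos_le_cos_of_nonneg_of_le_pi (abs_nonneg _) <;> linarith [Real.pi_pos]
  have h1 : |D| * |Real.sin (2 * T)| ≤ |x| := by
    rw [← abs_mul, ← sub_eq_zero.mp hcrit, abs_mul]
    exact mul_le_of_le_one_right (abs_nonneg _) (Real.abs_cos_le_one _)
  have h2 : |Real.sin T| ≤ |Real.sin (2 * T)| := by
    rw [Real.sin_two_mul, abs_mul, abs_mul, abs_two, abs_of_nonneg (by linarith : 0 ≤ Real.cos T)]
    nlinarith [abs_nonneg (Real.sin T)]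
  have h3 : d * |Real.sin T| ≤ ‖A l r‖ :=
    calc _ ≤ |D| * |Real.sin (2 * T)| := mul_le_mul hD h2 (abs_nonneg _) (abs_nonneg _)
      _ ≤ _ := h1.trans hx
  have h4 : |Real.sin T| ≤ ‖A l r‖ / d := by
    rw [le_div_iff₀ hd, mul_comm]; exact h3
  have h5 : |Real.sin θ - Real.sin T| ≤ |θ - T| := Real.abs_sin_sub_sin_le θ T
  have h6 := abs_sub_abs_le_abs_sub (Real.sin θ) (Real.sin T)
  linarith

end StepBounds

/-! ### Off-diagonal mass. -/

section OffDiagonal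

variable {n : ℕ} {A : Matrix (Fin n) (Fin n) ℂ}

/-- The sum of the squared moduli of the off-diagonal entries. -/
noncomputable def offSq (A : Matrix (Fin n) (Fin n) ℂ) : ℝ :=
  weightedSq (fun p q => if p = q then 0 else 1) A

theorem weightedSq_nonneg {w : Fin n → Fin n → ℝ} (hw : ∀ p q, 0 ≤ w p q)
    (A : Matrix (Fin n) (Fin n) ℂ) : 0 ≤ weightedSq w A :=
  Finset.sum_nonneg fun p _ => Finset.sum_nonneg fun q _ =>
    mul_nonneg (hw p q) (sq_nonneg _)

theorem weightedSq_add (w w' : Fin n → Fin n → ℝ) (A : Matrix (Fin n) (Fin n) ℂ) :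
    weightedSq (fun p q => w p q + w' p q) A = weightedSq w A + weightedSq w' A := by
  simp only [weightedSq, add_mul, Finset.sum_add_distrib]

/-- The indicator of the two positions `(l, r)` and `(r, l)`. -/
noncomputable def pairWeight (l r p q : Fin n) : ℝ :=
  (if p = l ∧ q = r then 1 else 0) + (if p = r ∧ q = l then 1 else 0)

theorem weightedSq_pairWeight (hA : A.IsHermitian) (l r : Fin n) :
    weightedSq (pairWeight l r) A = 2 * ‖A l r‖ ^ 2 := by
  have h : ∀ a b : Fin n,
      weightedSq (fun p q => if p = a ∧ q = b then 1 else 0) A = ‖A a b‖ ^ 2 := by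
    intro a b
    rw [weightedSq, Finset.sum_eq_single a, Finset.sum_eq_single b]
    · simp
    · intro q _ hq; simp [hq]
    · simp
    · intro p _ hp; simp [hp]
    · simp
  have h2 : ‖A r l‖ = ‖A l r‖ := by rw [← hA.apply, norm_star]
  have := weightedSq_add (fun p q => if p = l ∧ q = r then 1 else 0)
    (fun p q => if p = r ∧ q = l then 1 else 0) A
  rw [h, h, h2] at this
  rw [two_mul, ← this]
  rfl

theorem offNorm_sq (hA : A.IsHermitian) : offNorm A ^ 2 = offSq A / 2 := by
  have h0 : 0 ≤ ∑ i, ∑ j, if i < j then ‖A i j‖ ^ 2 else 0 :=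
    Finset.sum_nonneg fun p _ => Finset.sum_nonneg fun q _ => by split_ifs <;> positivity
  rw [offNorm, Real.sq_sqrt h0]
  have h1 : offSq A = (∑ i, ∑ j, if i < j then ‖A i j‖ ^ 2 else 0)
      + ∑ i, ∑ j, if j < i then ‖A i j‖ ^ 2 else 0 := by
    rw [offSq, weightedSq, ← Finset.sum_add_distrib]
    refine Finset.sum_congr rfl fun i _ => ?_
    rw [← Finset.sum_add_distrib]
    refine Finset.sum_congr rfl fun j _ => ?_
    rcases lt_trichotomy i j with h | h | h
    · simp [h, h.ne, h.not_gt]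
    · simp [h]
    · simp [h, h.ne', h.not_gt]
  have h2 : (∑ i, ∑ j, if j < i then ‖A i j‖ ^ 2 else 0)
      = ∑ i, ∑ j, if i < j then ‖A i j‖ ^ 2 else 0 := by
    rw [Finset.sum_comm]
    refine Finset.sum_congr rfl fun i _ => Finset.sum_congr rfl fun j _ => ?_
    rw [← hA.apply, norm_star]
  rw [h1, h2]; ring

/-- Off-diagonal positions split into the pivot pair and the rest. The indicator of the rest does
not distinguish `l` from `r`, so that part is invariant. -/
theorem offSq_rotate {l r : Fin n} (h : l ≠ r) (θ φ : ℝ) (hA : A.IsHermitian) :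
    offSq (rotate l r θ φ A) = offSq A - 2 * ‖A l r‖ ^ 2 + 2 * ‖rotate l r θ φ A l r‖ ^ 2 := by
  let w : Fin n → Fin n → ℝ := fun p q =>
    if p = q ∨ ((p = l ∨ p = r) ∧ (q = l ∨ q = r)) then 0 else 1
  have hsplit : (fun p q : Fin n => if p = q then (0 : ℝ) else 1)
      = fun p q => w p q + pairWeight l r p q := by
    funext p q
    simp only [w, pairWeight]
    by_cases hp : p = l <;> by_cases hp' : p = r <;> by_cases hq : q = l <;>
      by_cases hq' : q = r <;> by_cases hpq : p = q <;> simp_all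
  have hinv : weightedSq w (rotate l r θ φ A) = weightedSq w A := by
    refine weightedSq_rotate h θ φ (fun p => ?_) (fun p => ?_) A
    · by_cases hp : p = l <;> by_cases hp' : p = r <;> simp_all [w]
    · by_cases hp : p = l <;> by_cases hp' : p = r <;> simp_all [w, eq_comm]
  rw [offSq, offSq, hsplit, weightedSq_add, weightedSq_add, hinv, weightedSq_pairWeight hA,
    weightedSq_pairWeight (rotate_isHermitian hA)]
  ring

/-- The sum of the squared moduli of the off-diagonal entries of a row. -/
noncomputable def rowSq (A : Matrix (Fin n) (Fin n) ℂ) (i : Fin n) : ℝ :=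
  ∑ j, (if i = j then 0 else 1) * ‖A i j‖ ^ 2

/-- By Hermitian symmetry the row's off-diagonal mass occurs a second time in the column. -/
theorem rowSq_le_offSq (hA : A.IsHermitian) (i : Fin n) :
    rowSq A i ≤ offSq A / 2 := by
  rw [rowSq]
  have h1 : offSq A = ∑ j, (if i = j then 0 else 1) * ‖A i j‖ ^ 2
      + ∑ p ∈ Finset.univ.erase i, ∑ q, (if p = q then 0 else 1) * ‖A p q‖ ^ 2 := by
    exact (Finset.add_sum_erase Finset.univ
      (fun p => ∑ q, (if p = q then (0 : ℝ) else 1) * ‖A p q‖ ^ 2) (Finset.mem_univ i)).symm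
  have h2 : ∑ j, (if i = j then 0 else 1) * ‖A i j‖ ^ 2
      ≤ ∑ p ∈ Finset.univ.erase i, ∑ q, (if p = q then 0 else 1) * ‖A p q‖ ^ 2 := by
    rw [← Finset.add_sum_erase _ _ (Finset.mem_univ i), if_pos rfl, zero_mul, zero_add]
    refine Finset.sum_le_sum fun p hp => ?_
    have hpi := Finset.ne_of_mem_erase hp
    refine le_trans (le_of_eq ?_) (Finset.single_le_sum
      (f := fun q => (if p = q then (0 : ℝ) else 1) * ‖A p q‖ ^ 2)
      (fun q _ => mul_nonneg (by split_ifs <;> norm_num) (sq_nonneg _)) (Finset.mem_univ i))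
    rw [← hA.apply i p, norm_star, if_neg hpi, if_neg hpi.symm]
  linarith

theorem norm_sq_le_offSq (hA : A.IsHermitian) {i j : Fin n} (h : i ≠ j) :
    ‖A i j‖ ^ 2 ≤ offSq A / 2 := by
  refine le_trans (le_trans (le_of_eq ?_) (Finset.single_le_sum
    (f := fun j => (if i = j then (0 : ℝ) else 1) * ‖A i j‖ ^ 2)
    (fun q _ => mul_nonneg (by split_ifs <;> norm_num) (sq_nonneg _)) (Finset.mem_univ j)))
    (rowSq_le_offSq hA i)
  simp [h]

theorem offSq_nonneg (A : Matrix (Fin n) (Fin n) ℂ) : 0 ≤ offSq A :=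
  weightedSq_nonneg (fun p q => by split_ifs <;> norm_num) A

theorem offSq_of_reindex {B : Matrix (Fin n) (Fin n) ℂ} (π : Equiv.Perm (Fin n))
    (h : ∀ i j, B (π i) (π j) = A i j) : offSq B = offSq A := by
  rw [offSq, offSq, weightedSq, weightedSq, ← Equiv.sum_comp π]
  refine Finset.sum_congr rfl fun i _ => ?_
  rw [← Equiv.sum_comp π]
  simp [h]

end OffDiagonal

/-! ### Diagonal entries, eigenvalues and multiplicities. -/

section Spectrum

open scoped ComplexOrder

variable {n : ℕ} {lam : Fin n → ℝ} {A : Matrix (Fin n) (Fin n) ℂ}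

/-- `A` is unitarily equivalent to the diagonal matrix with entries `lam`. -/
def HasSpectrum (lam : Fin n → ℝ) (A : Matrix (Fin n) (Fin n) ℂ) : Prop :=
  ∃ V : Matrix (Fin n) (Fin n) ℂ, Vᴴ * V = 1 ∧ V * Vᴴ = 1 ∧
    A = V * diagonal (fun q => (lam q : ℂ)) * Vᴴ

theorem HasSpectrum.isHermitian (h : HasSpectrum lam A) : A.IsHermitian := by
  obtain ⟨V, -, -, rfl⟩ := h
  refine isHermitian_mul_mul_conjTranspose _ ?_
  rw [IsHermitian, diagonal_conjTranspose]
  congr 1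
  ext q
  simp

theorem HasSpectrum.conj (h : HasSpectrum lam A) {U : Matrix (Fin n) (Fin n) ℂ}
    (h1 : Uᴴ * U = 1) (h2 : U * Uᴴ = 1) : HasSpectrum lam (Uᴴ * A * U) := by
  obtain ⟨V, hV, hV', rfl⟩ := h
  refine ⟨Uᴴ * V, ?_, ?_, ?_⟩
  · rw [conjTranspose_mul, conjTranspose_conjTranspose, Matrix.mul_assoc, ← Matrix.mul_assoc U, h2,
      Matrix.one_mul, hV]
  · rw [conjTranspose_mul, conjTranspose_conjTranspose, Matrix.mul_assoc, ← Matrix.mul_assoc V, hV',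
      Matrix.one_mul, h1]
  · simp only [conjTranspose_mul, conjTranspose_conjTranspose, Matrix.mul_assoc]

theorem HasSpectrum.rotate (h : HasSpectrum lam A) {l r : Fin n} (hlr : l ≠ r) (θ φ : ℝ) :
    HasSpectrum lam (rotate l r θ φ A) :=
  h.conj (jacobiRotation_conjTranspose_mul_self hlr θ φ)
    (jacobiRotation_mul_conjTranspose_self hlr θ φ)

theorem IsHermitian.hasSpectrum (hA : A.IsHermitian) : HasSpectrum hA.eigenvalues A := by
  refine ⟨hA.eigenvectorUnitary, ?_, ?_, ?_⟩
  · exact Unitary.coe_star_mul_self _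
  · exact Unitary.coe_mul_star_self _
  · conv_lhs => rw [hA.spectral_theorem]
    rfl

theorem HasSpectrum.posSemidef (h : HasSpectrum lam A) (hlam : ∀ q, 0 ≤ lam q) :
    A.PosSemidef := by
  obtain ⟨V, -, -, rfl⟩ := h
  refine PosSemidef.mul_mul_conjTranspose_same (PosSemidef.diagonal fun q => ?_) V
  simpa using hlam q

theorem HasSpectrum.smul_one_sub (h : HasSpectrum lam A) (N : ℝ) :
    HasSpectrum (fun q => N - lam q) ((N : ℂ) • (1 : Matrix (Fin n) (Fin n) ℂ) - A) := by
  obtain ⟨V, hV, hV', rfl⟩ := h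
  refine ⟨V, hV, hV', ?_⟩
  have : diagonal (fun q => ((N - lam q : ℝ) : ℂ))
      = (N : ℂ) • (1 : Matrix (Fin n) (Fin n) ℂ) - diagonal (fun q => (lam q : ℂ)) := by
    ext i j
    by_cases hij : i = j
    · subst hij; simp
    · simp [hij]
  rw [this, Matrix.mul_sub, Matrix.sub_mul]
  simp [hV']

/-- This is the nonnegativity of a principal 2×2 minor. -/
theorem PosSemidef.norm_sq_le_mul (hA : A.PosSemidef) (l r : Fin n) :
    ‖A l r‖ ^ 2 ≤ (A l l).re * (A r r).re := by
  have h := (hA.submatrix ![l, r]).det_nonneg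
  rw [det_fin_two] at h
  simp only [submatrix_apply, cons_val_zero, cons_val_one] at h
  have h1 : A r l = star (A l r) := (hA.1.apply r l).symm
  rw [h1, Complex.star_def, Complex.mul_conj', apply_self_eq_re hA.1 l,
    apply_self_eq_re hA.1 r] at h
  norm_cast at h
  linarith

/-- The oscillation of the quadratic form on a block is at most the width of the spectrum. -/
theorem HasSpectrum.halfDiff_sq_add_le (h : HasSpectrum lam A) {N : ℝ}
    (h0 : ∀ q, 0 ≤ lam q) (hN : ∀ q, lam q ≤ N) {l r : Fin n} (hlr : l ≠ r) :
    halfDiff A l r ^ 2 + ‖A l r‖ ^ 2 ≤ N ^ 2 / 4 := by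
  have p1 := h.posSemidef h0
  have p2 := (h.smul_one_sub N).posSemidef (fun q => sub_nonneg.mpr (hN q))
  have h1 := PosSemidef.norm_sq_le_mul p1 l r
  have h2 := PosSemidef.norm_sq_le_mul p2 l r
  have d1 : ∀ i, 0 ≤ (A i i).re := fun i => (Complex.le_def.mp (p1.diag_nonneg (i := i))).1
  have d2 : ∀ i, 0 ≤ N - (A i i).re := fun i => by
    have := (Complex.le_def.mp (p2.diag_nonneg (i := i))).1
    simpa using this
  simp only [Matrix.sub_apply, Matrix.smul_apply, one_apply_eq, one_apply_ne hlr, smul_eq_mul, mul_one, mul_zero,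
    zero_sub, norm_neg, Complex.sub_re, Complex.ofReal_re] at h2
  have := d1 l
  have := d1 r
  have := d2 l
  have := d2 r
  rw [halfDiff]
  generalize (A l l).re = a at *
  generalize (A r r).re = b at *
  -- Adding `((a - b) / 2) ^ 2` to the minor bounds for `A` and `N - A` gives `((a + b) / 2) ^ 2`
  -- and `(N - (a + b) / 2) ^ 2`; the smaller is at most `N ^ 2 / 4`.
  rcases le_total (a + b) N with hs | hs
  · nlinarith
  · nlinarith

/-- The norm of a row of `A - μ` in terms of the spectrum. -/
theorem sum_row_sub_eq {V : Matrix (Fin n) (Fin n) ℂ} (hV : Vᴴ * V = 1)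
    (hA : A = V * diagonal (fun q => (lam q : ℂ)) * Vᴴ) (hV' : V * Vᴴ = 1) (μ : ℝ) (i : Fin n) :
    ∑ q, (lam q - μ) ^ 2 * ‖V i q‖ ^ 2
      = ((A i i).re - μ) ^ 2 + rowSq A i := by
  rw [rowSq]
  have hH : A.IsHermitian := HasSpectrum.isHermitian ⟨V, hV, hV', hA⟩
  set D : Matrix (Fin n) (Fin n) ℂ := diagonal (fun q => ((lam q - μ : ℝ) : ℂ)) with hD
  have hDA : A - (μ : ℂ) • 1 = V * D * Vᴴ := by
    have : D = diagonal (fun q => (lam q : ℂ)) - (μ : ℂ) • (1 : Matrix (Fin n) (Fin n) ℂ) := by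
      ext i j
      by_cases hij : i = j
      · subst hij; simp [hD]
      · simp [hD, hij]
    rw [this, Matrix.mul_sub, Matrix.sub_mul, ← hA]
    simp [hV']
  have hDH : Dᴴ = D := by
    rw [hD, diagonal_conjTranspose]
    congr 1
    ext q
    simp
  have hsq : (A - (μ : ℂ) • 1) * (A - (μ : ℂ) • 1)ᴴ = V * (D * D) * Vᴴ := by
    rw [hDA, conjTranspose_mul, conjTranspose_mul, conjTranspose_conjTranspose, hDH]
    calc V * D * Vᴴ * (V * (D * Vᴴ)) = V * D * (Vᴴ * V) * (D * Vᴴ) := by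
          simp only [Matrix.mul_assoc]
      _ = _ := by rw [hV, Matrix.mul_one]; simp only [Matrix.mul_assoc]
  have hii := congrFun (congrFun hsq i) i
  rw [hD, diagonal_mul_diagonal, Matrix.mul_apply, Matrix.mul_apply] at hii
  simp only [conjTranspose_apply, mul_diagonal, Complex.star_def, Complex.mul_conj'] at hii
  have hr : ∀ x, V i x * (((lam x - μ : ℝ) : ℂ) * ((lam x - μ : ℝ) : ℂ)) * (starRingEnd ℂ) (V i x)
      = (((lam x - μ) ^ 2 * ‖V i x‖ ^ 2 : ℝ) : ℂ) := by
    intro x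
    have := Complex.mul_conj' (V i x)
    push_cast
    linear_combination ((lam x : ℂ) - μ) ^ 2 * this
  simp only [hr] at hii
  have hii' : ∑ x, ‖(A - (μ : ℂ) • 1) i x‖ ^ 2 = ∑ x, (lam x - μ) ^ 2 * ‖V i x‖ ^ 2 := by
    exact_mod_cast hii
  rw [← hii', ← Finset.add_sum_erase _ _ (Finset.mem_univ i),
    ← Finset.add_sum_erase (a := i) Finset.univ
      (fun j => (if i = j then (0 : ℝ) else 1) * ‖A i j‖ ^ 2) (Finset.mem_univ i)]
  congr 1
  · rw [Matrix.sub_apply, apply_self_eq_re hH i, Matrix.smul_apply, one_apply_eq, smul_eq_mul, mul_one,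
      ← Complex.ofReal_sub, Complex.norm_real, Real.norm_eq_abs, sq_abs, Complex.ofReal_re]
  · rw [if_pos rfl, zero_mul, zero_add]
    refine Finset.sum_congr rfl fun j hj => ?_
    have := Finset.ne_of_mem_erase hj
    simp [one_apply_ne this.symm, this.symm]

theorem sum_norm_sq_row {V : Matrix (Fin n) (Fin n) ℂ} (hV : V * Vᴴ = 1) (i : Fin n) :
    ∑ q, ‖V i q‖ ^ 2 = 1 := by
  have h := congrFun (congrFun hV i) i
  rw [Matrix.mul_apply, one_apply_eq] at h
  simp only [conjTranspose_apply, Complex.star_def, Complex.mul_conj'] at h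
  exact_mod_cast h

theorem sum_norm_sq_col {V : Matrix (Fin n) (Fin n) ℂ} (hV : Vᴴ * V = 1) (q : Fin n) :
    ∑ i, ‖V i q‖ ^ 2 = 1 := by
  have h := congrFun (congrFun hV q) q
  rw [Matrix.mul_apply, one_apply_eq] at h
  simp only [conjTranspose_apply, Complex.star_def, Complex.conj_mul'] at h
  exact_mod_cast h

/-- Each diagonal entry is close to an eigenvalue. -/
theorem HasSpectrum.exists_near (h : HasSpectrum lam A) (i : Fin n) :
    ∃ q, ((A i i).re - lam q) ^ 2 ≤ rowSq A i := by
  by_contra! hcon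
  obtain ⟨V, hV, hV', hA⟩ := h
  -- With `μ` equal to the diagonal entry, `rowSq A i` is the average of the squared distances to
  -- the eigenvalues with weights `‖V i q‖ ^ 2`, so it cannot be smaller than all of them.
  have h1 := sum_row_sub_eq hV hA hV' (A i i).re i
  rw [sub_self, zero_pow two_ne_zero, zero_add] at h1
  have h3 : rowSq A i < ∑ q, (lam q - (A i i).re) ^ 2 * ‖V i q‖ ^ 2 := by
    have h4 : rowSq A i = ∑ q, rowSq A i * ‖V i q‖ ^ 2 := by
      rw [← Finset.mul_sum, sum_norm_sq_row hV', mul_one]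
    rw [h4]
    refine Finset.sum_lt_sum (fun q _ => ?_) ?_
    · refine mul_le_mul_of_nonneg_right ?_ (sq_nonneg _)
      have := hcon q
      linarith [sub_sq_comm (A i i).re (lam q)]
    · by_contra! h5
      have h6 : ∑ q, ‖V i q‖ ^ 2 = 0 := by
        refine Finset.sum_eq_zero fun q hq => ?_
        have h7 := h5 q hq
        by_contra h8
        have h9 : 0 < ‖V i q‖ ^ 2 := lt_of_le_of_ne (sq_nonneg _) (Ne.symm h8)
        have h10 := le_of_mul_le_mul_right h7 h9
        linarith [sub_sq_comm (A i i).re (lam q), hcon q]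
      rw [sum_norm_sq_row hV'] at h6
      exact one_ne_zero h6
  linarith

/-- Off-diagonal entries belonging to one eigenvalue are quadratically small. -/
theorem HasSpectrum.norm_apply_le_of_near (h : HasSpectrum lam A) {g μ : ℝ} (hg : 0 < g)
    (hgap : ∀ q, lam q ≠ μ → g ≤ |lam q - μ|) {i j : Fin n} (hij : i ≠ j)
    (hi : ((A i i).re - μ) ^ 2 ≤ rowSq A i) (hj : ((A j j).re - μ) ^ 2 ≤ rowSq A j) :
    ‖A i j‖ ≤ offSq A / g := by
  have hH := h.isHermitian
  obtain ⟨V, hV, hV', hA⟩ := h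
  have h1 := sum_row_sub_eq hV hA hV' μ i
  have h2 := sum_row_sub_eq hV hA hV' μ j
  have h3 := rowSq_le_offSq hH i
  have h4 := rowSq_le_offSq hH j
  have hone : (V * Vᴴ) i j = 0 := by rw [hV', one_apply_ne hij]
  -- Orthogonality of rows `i` and `j` of `V` allows subtracting `μ`, so eigenvalues equal to `μ`
  -- drop out.
  have hAij : A i j = ∑ q, ((lam q - μ : ℝ) : ℂ) * (V i q * star (V j q)) := by
    have h5 : A i j = ∑ q, (lam q : ℂ) * (V i q * star (V j q)) := by
      conv_lhs => rw [hA]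
      rw [Matrix.mul_apply]
      refine Finset.sum_congr rfl fun q _ => ?_
      rw [mul_diagonal, conjTranspose_apply]
      ring
    rw [Matrix.mul_apply] at hone
    simp only [conjTranspose_apply] at hone
    have h6 : ∑ q, (μ : ℂ) * (V i q * star (V j q)) = 0 := by
      rw [← Finset.mul_sum, hone, mul_zero]
    rw [h5, ← sub_zero (∑ q, (lam q : ℂ) * (V i q * star (V j q))), ← h6, ← Finset.sum_sub_distrib]
    refine Finset.sum_congr rfl fun q _ => ?_
    push_cast
    ring
  -- The gap turns `|lam q - μ|` into a square at the cost of `1 / g`, and the mean inequality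
  -- separates the two rows; the row identities then make the bound quadratic.
  have h5 : ‖A i j‖ ≤ ∑ q, (1 / (2 * g)) *
      ((lam q - μ) ^ 2 * ‖V i q‖ ^ 2 + (lam q - μ) ^ 2 * ‖V j q‖ ^ 2) := by
    rw [hAij]
    refine (norm_sum_le _ _).trans (Finset.sum_le_sum fun q _ => ?_)
    rw [norm_mul, norm_mul, norm_star, Complex.norm_real, Real.norm_eq_abs]
    have hq : |lam q - μ| * g ≤ (lam q - μ) ^ 2 := by
      by_cases hq : lam q = μ
      · simp [hq]
      · rw [← sq_abs, sq]
        exact mul_le_mul_of_nonneg_left (hgap q hq) (abs_nonneg _)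
    have hab : ‖V i q‖ * ‖V j q‖ ≤ (‖V i q‖ ^ 2 + ‖V j q‖ ^ 2) / 2 := by
      nlinarith [sq_nonneg (‖V i q‖ - ‖V j q‖)]
    rw [← mul_add, div_mul_eq_mul_div, one_mul, le_div_iff₀ (by positivity)]
    calc _ = (|lam q - μ| * g) * (2 * (‖V i q‖ * ‖V j q‖)) := by ring
      _ ≤ (lam q - μ) ^ 2 * (‖V i q‖ ^ 2 + ‖V j q‖ ^ 2) :=
        mul_le_mul hq (by linarith) (by positivity) (sq_nonneg _)
  rw [← Finset.mul_sum, Finset.sum_add_distrib, h1, h2] at h5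
  refine h5.trans ?_
  rw [div_mul_eq_mul_div, one_mul, div_le_div_iff₀ (by positivity) hg]
  nlinarith

/-- If every diagonal entry is close to the eigenvalue `σ i`, then each eigenvalue is attained by
`σ` with its multiplicity. -/
theorem HasSpectrum.card_near_eq (h : HasSpectrum lam A) {g : ℝ} (hg : 0 < g) {σ : Fin n → ℝ}
    (hgap : ∀ i q, lam q ≠ σ i → g ≤ |lam q - σ i|)
    (hnear : ∀ i, ((A i i).re - σ i) ^ 2 ≤ rowSq A i)
    (hoff : 2 * offSq A < g ^ 2) (μ : ℝ) :
    (Finset.univ.filter fun i => σ i = μ).card = (Finset.univ.filter fun q => lam q = μ).card := by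
  obtain ⟨V, hV, hV', hA⟩ := h
  -- The mass of `‖V i q‖ ^ 2` on mismatched pairs is below one. The two cardinalities are sums of
  -- the same doubly stochastic weights and differ at most by this mass, so as integers they agree.
  have hT : ∑ i, ∑ q, (if lam q = σ i then 0 else 1) * ‖V i q‖ ^ 2 < 1 := by
    have h1 : g ^ 2 * ∑ i, ∑ q, (if lam q = σ i then 0 else 1) * ‖V i q‖ ^ 2
        ≤ ∑ i, 2 * rowSq A i := by
      rw [Finset.mul_sum]
      refine Finset.sum_le_sum fun i _ => ?_
      have h2 := sum_row_sub_eq hV hA hV' (σ i) i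
      have h3 := hnear i
      refine le_trans ?_ (h2.trans_le (by linarith))
      rw [Finset.mul_sum]
      refine Finset.sum_le_sum fun q _ => ?_
      rw [← mul_assoc]
      refine mul_le_mul_of_nonneg_right ?_ (sq_nonneg _)
      split_ifs with hq
      · rw [mul_zero]; exact sq_nonneg _
      · rw [mul_one, ← sq_abs (lam q - σ i)]
        exact pow_le_pow_left₀ hg.le (hgap i q hq) 2
    rw [← Finset.mul_sum] at h1
    have h2 : ∑ i, rowSq A i = offSq A := rfl
    rw [h2] at h1
    have h3 : 0 < g ^ 2 := by positivity
    by_contra! h4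
    nlinarith
  have hS : ((Finset.univ.filter fun i => σ i = μ).card : ℝ)
      = ∑ i, ∑ q, (if σ i = μ then 1 else 0) * ‖V i q‖ ^ 2 := by
    simp only [← Finset.mul_sum, sum_norm_sq_row hV', mul_one]
    simp
  have hM : ((Finset.univ.filter fun q => lam q = μ).card : ℝ)
      = ∑ i, ∑ q, (if lam q = μ then 1 else 0) * ‖V i q‖ ^ 2 := by
    rw [Finset.sum_comm]
    simp only [← Finset.mul_sum, sum_norm_sq_col hV, mul_one]
    simp
  have hdiff : |((Finset.univ.filter fun i => σ i = μ).card : ℝ)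
      - (Finset.univ.filter fun q => lam q = μ).card| < 1 := by
    refine lt_of_le_of_lt ?_ hT
    rw [hS, hM, ← Finset.sum_sub_distrib]
    refine (Finset.abs_sum_le_sum_abs _ _).trans (Finset.sum_le_sum fun i _ => ?_)
    rw [← Finset.sum_sub_distrib]
    refine (Finset.abs_sum_le_sum_abs _ _).trans (Finset.sum_le_sum fun q _ => ?_)
    rw [← sub_mul, abs_mul, abs_of_nonneg (sq_nonneg ‖V i q‖)]
    refine mul_le_mul_of_nonneg_right ?_ (sq_nonneg _)
    by_cases h1 : σ i = μ <;> by_cases h2 : lam q = μ <;> by_cases h3 : lam q = σ i <;> simp_all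
  have h1 : |((Finset.univ.filter fun i => σ i = μ).card : ℤ)
      - (Finset.univ.filter fun q => lam q = μ).card| < 1 := by exact_mod_cast hdiff
  rw [Int.abs_lt_one_iff] at h1
  omega

end Spectrum

/-! ### Which pairs precede a pivot in the row-cyclic order. -/

section CyclicOrder

variable {n : ℕ}

theorem mem_rowCyclicPairs {p : Fin n × Fin n} : p ∈ rowCyclicPairs n ↔ p.1 < p.2 := by
  obtain ⟨a, b⟩ := p
  simp [rowCyclicPairs]

/-- Being lexicographically sorted is what allows "visited earlier" to be decided by comparing
indices with the pivot. -/
theorem pairwise_rowCyclicPairs (n : ℕ) :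
    (rowCyclicPairs n).Pairwise fun a b => a.1 < b.1 ∨ a.1 = b.1 ∧ a.2 < b.2 := by
  refine List.Pairwise.filter _ ?_
  rw [SProd.sprod, List.instSProd]
  simp only [List.product]
  rw [List.pairwise_flatMap]
  constructor
  · intro a _
    rw [List.pairwise_map]
    exact (List.pairwise_lt_finRange n).imp fun h => Or.inr ⟨rfl, h⟩
  · refine (List.pairwise_lt_finRange n).imp fun h => ?_
    intro x hx y hy
    rw [List.mem_map] at hx hy
    obtain ⟨_, _, rfl⟩ := hx
    obtain ⟨_, _, rfl⟩ := hy
    exact Or.inl h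

/-- The pair `{a, b}` was visited before position `j` of the sweep. -/
def Visited (j : ℕ) (a b : Fin n) : Prop :=
  ∃ i < j, (rowCyclicPairs n)[i]? = some (a, b) ∨ (rowCyclicPairs n)[i]? = some (b, a)

theorem Visited.symm {j : ℕ} {a b : Fin n} (h : Visited j a b) : Visited j b a := by
  obtain ⟨i, hi, h⟩ := h
  exact ⟨i, hi, h.symm⟩

theorem visited_comm {j : ℕ} {a b : Fin n} : Visited j a b ↔ Visited j b a :=
  ⟨Visited.symm, Visited.symm⟩

theorem lt_of_getElem?_rowCyclicPairs {j : ℕ} {l r : Fin n}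
    (h : (rowCyclicPairs n)[j]? = some (l, r)) : l < r :=
  mem_rowCyclicPairs.mp (List.mem_of_getElem? h)

theorem visited_iff {j : ℕ} {l r a b : Fin n} (hj : (rowCyclicPairs n)[j]? = some (l, r))
    (hab : a < b) : Visited j a b ↔ a < l ∨ a = l ∧ b < r := by
  have hp := List.pairwise_iff_getElem.mp (pairwise_rowCyclicPairs n)
  obtain ⟨hjl, hje⟩ := List.getElem?_eq_some_iff.mp hj
  constructor
  · rintro ⟨i, hi, h | h⟩
    · obtain ⟨hil, hie⟩ := List.getElem?_eq_some_iff.mp h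
      have := hp i j hil hjl hi
      rwa [hie, hje] at this
    · exact absurd (lt_of_getElem?_rowCyclicPairs h) hab.not_gt
  · intro h
    obtain ⟨i, hi, hie⟩ := List.getElem_of_mem (mem_rowCyclicPairs.mpr hab : (a, b) ∈ _)
    refine ⟨i, ?_, Or.inl (List.getElem?_eq_some_iff.mpr ⟨hi, hie⟩)⟩
    by_contra! hji
    rcases hji.lt_or_eq with hlt | rfl
    · have := hp j i hjl hi hlt
      rw [hie, hje] at this
      simp only at this
      omega
    · rw [hie, Prod.mk.injEq] at hje
      obtain ⟨rfl, rfl⟩ := hje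
      simp at h

theorem visited_of_lt {a b : Fin n} (hab : a < b) : Visited (sweepLength n) a b := by
  obtain ⟨i, hi, hie⟩ := List.getElem_of_mem (mem_rowCyclicPairs.mpr hab : (a, b) ∈ _)
  exact ⟨i, (length_rowCyclicPairs n) ▸ hi, Or.inl (List.getElem?_eq_some_iff.mpr ⟨hi, hie⟩)⟩

theorem visited_sweepLength {a b : Fin n} (hab : a ≠ b) : Visited (sweepLength n) a b := by
  rcases lt_or_gt_of_ne hab with h | h
  · exact visited_of_lt h
  · exact (visited_of_lt h).symm

theorem exists_getElem?_rowCyclicPairs {j : ℕ} (hj : j < sweepLength n) :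
    ∃ p, (rowCyclicPairs n)[j]? = some p :=
  ⟨_, List.getElem?_eq_some_iff.mpr ⟨(length_rowCyclicPairs n).symm ▸ hj, rfl⟩⟩

/-- If the levels of `σ` are intervals, a pivot inside of a level has visited the same pairs in
its two rows, as far as other levels are concerned. -/
theorem visited_left_iff_visited_right {j : ℕ} {l r p : Fin n}
    (hj : (rowCyclicPairs n)[j]? = some (l, r)) {σ : Fin n → ℝ} (hσ : Antitone σ)
    (hlr : σ l = σ r) (hp : σ p ≠ σ l) : Visited j p l ↔ Visited j p r := by
  have hlt := lt_of_getElem?_rowCyclicPairs hj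
  rcases lt_trichotomy p l with h | rfl | h
  · rw [visited_iff hj h, visited_iff hj (h.trans hlt)]
    simp [h]
  · exact absurd rfl hp
  -- An index between `l` and `r` would lie in their level by monotonicity. Beyond `r`, neither pair
  -- has been visited yet; for `p < l` both have been.
  · rcases lt_trichotomy p r with h' | rfl | h'
    · exact absurd (le_antisymm (hσ h.le) (hlr ▸ hσ h'.le)) hp
    · exact absurd hlr.symm hp
    · rw [visited_comm, visited_iff hj h, visited_comm, visited_iff hj h']
      simp [hlt.not_gt, hlt.ne', h'.not_gt]

end CyclicOrder

/-! ### Analysis of one sweep. -/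

section Sweep

variable {n : ℕ} {lam : Fin n → ℝ} {η N δ : ℝ} {B : ℕ → Matrix (Fin n) (Fin n) ℂ}

/-- `B 0, …, B m` are the matrices of a row-cyclic sweep of plane rotations with angles returned
by line searches of accuracy `η`. -/
def IsSweep (η : ℝ) (B : ℕ → Matrix (Fin n) (Fin n) ℂ) : Prop :=
  ∀ j l r, (rowCyclicPairs n)[j]? = some (l, r) → ∃ θ φ,
    IsLineSearchResult (B j) l r η θ φ ∧ B (j + 1) = rotate l r θ φ (B j)

theorem IsSweep.hasSpectrum (hB : IsSweep η B) (h : HasSpectrum lam (B 0)) :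
    ∀ j ≤ sweepLength n, HasSpectrum lam (B j) := by
  intro j
  induction j with
  | zero => exact fun _ => h
  | succ j ih =>
    intro hj
    obtain ⟨⟨l, r⟩, hp⟩ := exists_getElem?_rowCyclicPairs (n := n) (j := j) hj
    obtain ⟨θ, φ, -, he⟩ := hB j l r hp
    rw [he]
    exact (ih (Nat.le_of_succ_le hj)).rotate (lt_of_getElem?_rowCyclicPairs hp).ne θ φ

theorem IsSweep.offSq_le (hB : IsSweep η B) (h : HasSpectrum lam (B 0))
    (h0 : ∀ q, 0 ≤ lam q) (hN : ∀ q, lam q ≤ N) :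
    ∀ j ≤ sweepLength n, offSq (B j) ≤ offSq (B 0) + j * (5 / 2 * (η ^ 2 * N ^ 2)) := by
  intro j
  induction j with
  | zero => simp
  | succ j ih =>
    intro hj
    obtain ⟨⟨l, r⟩, hp⟩ := exists_getElem?_rowCyclicPairs (n := n) (j := j) hj
    obtain ⟨θ, φ, hs, he⟩ := hB j l r hp
    have hsp := hB.hasSpectrum h j (Nat.le_of_succ_le hj)
    have hlr := (lt_of_getElem?_rowCyclicPairs hp).ne
    have h1 := hs.norm_rotate_sq_le hsp.isHermitian hlr (hsp.halfDiff_sq_add_le h0 hN hlr)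
    rw [he, offSq_rotate hlr θ φ hsp.isHermitian]
    have h2 := ih (Nat.le_of_succ_le hj)
    push_cast
    nlinarith [sq_nonneg ‖B j l r‖]

/-- The diagonal entries stay close to the same eigenvalues during a sweep. -/
theorem IsSweep.near (hB : IsSweep η B) (h : HasSpectrum lam (B 0))
    (h0 : ∀ q, 0 ≤ lam q) (hN : ∀ q, lam q ≤ N) (hN0 : 0 ≤ N) (hδ : 0 < δ)
    (hgap : ∀ p q, lam p ≠ lam q → 3 * δ ≤ |lam p - lam q|)
    (hoff : ∀ j ≤ sweepLength n, offSq (B j) / 2 ≤ (δ / 2) ^ 2) (hη : η * N ≤ δ / 4)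
    {σ : Fin n → ℝ} (hσ : ∀ i, ∃ q, lam q = σ i)
    (hnear : ∀ i, ((B 0 i i).re - σ i) ^ 2 ≤ rowSq (B 0) i) :
    ∀ j ≤ sweepLength n, ∀ i, ((B j i i).re - σ i) ^ 2 ≤ rowSq (B j) i := by
  intro j
  induction j with
  | zero => exact fun _ => hnear
  | succ j ih =>
    intro hj i
    have hj' := Nat.le_of_succ_le hj
    obtain ⟨⟨l, r⟩, hp⟩ := exists_getElem?_rowCyclicPairs (n := n) (j := j) hj
    obtain ⟨θ, φ, hs, he⟩ := hB j l r hp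
    have hsp := hB.hasSpectrum h j hj'
    have hsp' := hB.hasSpectrum h (j + 1) hj
    have hlr := (lt_of_getElem?_rowCyclicPairs hp).ne
    have hδ2 : 0 ≤ δ / 2 := by positivity
    have h1 := hs.abs_rotate_diag_sub_le hsp.isHermitian hlr hN0
      (hsp.halfDiff_sq_add_le h0 hN hlr) i
    rw [← he] at h1
    obtain ⟨q, hq⟩ := hsp'.exists_near i
    obtain ⟨q', hq'⟩ := hσ i
    have h2 : |(B (j + 1) i i).re - lam q| ≤ δ / 2 :=
      abs_le_of_sq_le_sq (hq.trans ((rowSq_le_offSq hsp'.isHermitian i).trans (hoff _ hj))) hδ2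
    have h3 : |(B j i i).re - σ i| ≤ δ / 2 :=
      abs_le_of_sq_le_sq ((ih hj' i).trans
        ((rowSq_le_offSq hsp.isHermitian i).trans (hoff _ hj'))) hδ2
    have h4 : ‖B j l r‖ ≤ δ / 2 :=
      (abs_le_of_sq_le_sq ((norm_sq_le_offSq hsp.isHermitian hlr).trans (hoff _ hj')) hδ2
        |> (le_abs_self _).trans)
    have h5 : lam q = σ i := by
      by_contra hne
      rw [← hq'] at hne h3
      have h6 := hgap q q' hne
      -- Two distances `δ / 2` to the eigenvalues plus a diagonal move of at most `δ + δ / 4`; this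
      -- stays below the gap `3 * δ`.
      have h7 : |lam q - lam q'| ≤ 9 / 4 * δ := by
        rw [abs_le] at h1 h2 h3 ⊢
        constructor <;> linarith [h1.1, h1.2, h2.1, h2.2, h3.1, h3.2]
      linarith
    rw [← h5]
    exact hq

open Classical in
/-- The indicator of the visited pairs which belong to different levels of `σ`. -/
noncomputable def visitedWeight (σ : Fin n → ℝ) (j : ℕ) (p q : Fin n) : ℝ :=
  if Visited j p q ∧ σ p ≠ σ q then 1 else 0

theorem visitedWeight_nonneg (σ : Fin n → ℝ) (j : ℕ) (p q : Fin n) :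
    0 ≤ visitedWeight σ j p q := by
  rw [visitedWeight]; split_ifs <;> norm_num

theorem visitedWeight_le_one (σ : Fin n → ℝ) (j : ℕ) (p q : Fin n) :
    visitedWeight σ j p q ≤ 1 := by
  rw [visitedWeight]; split_ifs <;> norm_num

theorem visitedWeight_comm (σ : Fin n → ℝ) (j : ℕ) (p q : Fin n) :
    visitedWeight σ j p q = visitedWeight σ j q p := by
  unfold visitedWeight
  split_ifs with h1 h2 h2
  · rfl
  · exact absurd ⟨h1.1.symm, h1.2.symm⟩ h2
  · exact absurd ⟨h2.1.symm, h2.2.symm⟩ h1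
  · rfl

theorem visitedWeight_left_eq_right {σ : Fin n → ℝ} (hσ : Antitone σ) {j : ℕ} {l r : Fin n}
    (hj : (rowCyclicPairs n)[j]? = some (l, r)) (hlr : σ l = σ r) (p : Fin n) :
    visitedWeight σ j p l = visitedWeight σ j p r := by
  by_cases hp : σ p = σ l
  · simp [visitedWeight, hp, hlr]
  · rw [visitedWeight, visitedWeight, visited_left_iff_visited_right hj hσ hlr hp, hlr]

theorem visitedWeight_succ_of_not {σ : Fin n → ℝ} {j : ℕ} {l r p q : Fin n}
    (hj : (rowCyclicPairs n)[j]? = some (l, r))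
    (hpq : ¬ (p = l ∧ q = r ∨ p = r ∧ q = l) ∨ σ p = σ q) :
    visitedWeight σ (j + 1) p q = visitedWeight σ j p q := by
  rcases hpq with hpq | hpq
  · have : Visited (j + 1) p q ↔ Visited j p q := by
      constructor
      · rintro ⟨i, hi, h⟩
        rcases Nat.lt_succ_iff_lt_or_eq.mp hi with hi | rfl
        · exact ⟨i, hi, h⟩
        · rw [hj] at h
          simp only [Option.some.injEq, Prod.mk.injEq] at h
          exact absurd (by tauto) hpq
      · rintro ⟨i, hi, h⟩
        exact ⟨i, hi.trans (Nat.lt_succ_self j), h⟩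
    rw [visitedWeight, visitedWeight, this]
  · simp [visitedWeight, hpq]

theorem sum_sum_const (c : ℝ) : ∑ _p : Fin n, ∑ _q : Fin n, c = (n : ℝ) ^ 2 * c := by
  simp; ring

/-- One rotation changes the sum of squares of the visited entries by little. -/
theorem weightedSq_visitedWeight_succ_le {A : Matrix (Fin n) (Fin n) ℂ} (hA : HasSpectrum lam A)
    (h0 : ∀ q, 0 ≤ lam q) (hN : ∀ q, lam q ≤ N) (hδ : 0 < δ)
    (hgap : ∀ p q, lam p ≠ lam q → 3 * δ ≤ |lam p - lam q|)
    {R : ℝ} (hR : 0 ≤ R) (hRδ : R ≤ δ / 2) (hoff : offSq A / 2 ≤ R ^ 2) (hη : η ≤ R / δ)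
    {σ : Fin n → ℝ} (hσ : Antitone σ) (hσl : ∀ i, ∃ q, lam q = σ i)
    (hnear : ∀ i, ((A i i).re - σ i) ^ 2 ≤ rowSq A i)
    {j : ℕ} {l r : Fin n} (hj : (rowCyclicPairs n)[j]? = some (l, r)) {θ φ : ℝ}
    (hs : IsLineSearchResult A l r η θ φ) {t : ℝ} (ht : 0 < t) :
    weightedSq (visitedWeight σ (j + 1)) (rotate l r θ φ A)
      ≤ (1 + 1 / t) * weightedSq (visitedWeight σ j) A
        + ((1 + t) * (n ^ 2 * (2 * R ^ 2 / δ) ^ 2) + 5 / 2 * (η ^ 2 * N ^ 2)) := by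
  have hH := hA.isHermitian
  have hlt := lt_of_getElem?_rowCyclicPairs hj
  have hW := weightedSq_nonneg (visitedWeight_nonneg σ j) A
  by_cases hlr : σ l = σ r
  -- For a pivot inside a level the angle is uncontrolled, but the weights do not distinguish `l`
  -- from `r`, so the visited mass is exactly preserved.
  · have hw : visitedWeight σ (j + 1) = visitedWeight σ j := by
      funext p q
      refine visitedWeight_succ_of_not hj ?_
      by_cases hpq : p = l ∧ q = r ∨ p = r ∧ q = l
      · right
        rcases hpq with ⟨rfl, rfl⟩ | ⟨rfl, rfl⟩
        · exact hlr
        · exact hlr.symm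
      · exact Or.inl hpq
    rw [hw, weightedSq_rotate hlt.ne θ φ (visitedWeight_left_eq_right hσ hj hlr)
      (fun p => by
        rw [visitedWeight_comm, visitedWeight_left_eq_right hσ hj hlr, visitedWeight_comm])]
    have h1 : 0 ≤ 1 / t * weightedSq (visitedWeight σ j) A := by positivity
    have h2 : 0 ≤ (1 + t) * (n ^ 2 * (2 * R ^ 2 / δ) ^ 2) + 5 / 2 * (η ^ 2 * N ^ 2) := by positivity
    linarith
  · have hdiag : ∀ i, |(A i i).re - σ i| ≤ R := fun i =>
      abs_le_of_sq_le_sq ((hnear i).trans ((rowSq_le_offSq hH i).trans hoff)) hR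
    have hM : ∀ p q, p ≠ q → ‖A p q‖ ≤ R := fun p q hpq =>
      (le_abs_self _).trans (abs_le_of_sq_le_sq ((norm_sq_le_offSq hH hpq).trans hoff) hR)
    -- Across levels the diagonal entries differ by at least `3 * δ - 2 * R ≥ 2 * δ`.
    have hD : δ ≤ |halfDiff A l r| := by
      obtain ⟨q, hq⟩ := hσl l
      obtain ⟨q', hq'⟩ := hσl r
      have h1 := hgap q q' (by rwa [hq, hq'])
      have h2 := hdiag l
      have h3 := hdiag r
      rw [hq, hq'] at h1
      rw [halfDiff]
      rw [abs_le] at h2 h3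
      rcases le_abs.mp h1 with h1 | h1
      · exact le_abs.mpr (Or.inl (by linarith))
      · exact le_abs.mpr (Or.inr (by linarith))
    have hsin : |Real.sin θ| ≤ 2 * R / δ := by
      refine (hs.abs_sin_le_div_add hH hlt.ne hδ hD).trans ?_
      have h1 : ‖A l r‖ / δ ≤ R / δ := by
        have := hM l r hlt.ne
        gcongr
      have h2 : 2 * R / δ = R / δ + R / δ := by ring
      linarith
    have hE := hs.norm_rotate_sq_le hH hlt.ne (hA.halfDiff_sq_add_le h0 hN hlt.ne)
    set y := 2 * R ^ 2 / δ with hy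
    have hsy : |Real.sin θ| * R ≤ y := by
      calc _ ≤ 2 * R / δ * R := mul_le_mul_of_nonneg_right hsin hR
        _ = y := by rw [hy]; ring
    have hy0 : 0 ≤ y := by positivity
    have key : ∀ p q, visitedWeight σ (j + 1) p q * ‖rotate l r θ φ A p q‖ ^ 2
        ≤ ((1 + 1 / t) * (visitedWeight σ j p q * ‖A p q‖ ^ 2) + (1 + t) * y ^ 2)
          + pairWeight l r p q * ‖rotate l r θ φ A p q‖ ^ 2 := by
      intro p q
      have hw0 := visitedWeight_nonneg σ j p q
      have hw1 := visitedWeight_le_one σ j p q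
      have hpair : 0 ≤ pairWeight l r p q := by
        rw [pairWeight]; positivity
      have hrest : 0 ≤ (1 + 1 / t) * (visitedWeight σ j p q * ‖A p q‖ ^ 2) + (1 + t) * y ^ 2 := by
        positivity
      -- The pivot pair joins the visited set with only its noise residue; every other visited entry
      -- changes by at most `y`.
      by_cases hpq : (p = l ∧ q = r) ∨ (p = r ∧ q = l)
      · have h1 : (1 : ℝ) ≤ pairWeight l r p q := by
          rw [pairWeight]
          rcases hpq with hpq | hpq
          · rw [if_pos hpq]; split_ifs <;> norm_num
          · rw [if_pos hpq]; split_ifs <;> norm_num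
        have h2 := (visitedWeight_le_one σ (j + 1) p q).trans h1
        have h3 := mul_le_mul_of_nonneg_right h2 (sq_nonneg ‖rotate l r θ φ A p q‖)
        linarith
      · have hpr := mul_nonneg hpair (sq_nonneg ‖rotate l r θ φ A p q‖)
        rw [visitedWeight_succ_of_not hj (Or.inl hpq)]
        by_cases hb : (p = l ∨ p = r) ∧ (q = l ∨ q = r)
        · have hpq' : p = q := by
            rcases hb with ⟨rfl | rfl, rfl | rfl⟩ <;> simp_all
          have : visitedWeight σ j p q = 0 := by simp [visitedWeight, hpq']
          rw [this, zero_mul]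
          rw [this] at hrest
          linarith
        · have h1 := norm_rotate_apply_le hlt.ne θ φ hH hR hM p q hb
          have h2 : ‖rotate l r θ φ A p q‖ ≤ ‖A p q‖ + y := by linarith
          have h3 : ‖rotate l r θ φ A p q‖ ^ 2 ≤ (1 + 1 / t) * ‖A p q‖ ^ 2 + (1 + t) * y ^ 2 := by
            refine (pow_le_pow_left₀ (norm_nonneg _) h2 2).trans ?_
            -- Weighted mean inequality for the cross term; `t` stays free, so that the growth
            -- factor can be tuned to the length of the sweep.
            have h4 : 0 ≤ 1 / t * (‖A p q‖ - t * y) ^ 2 := by positivity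
            have h5 : 1 / t * (‖A p q‖ - t * y) ^ 2
                = 1 / t * ‖A p q‖ ^ 2 - 2 * ‖A p q‖ * y + t * y ^ 2 := by
              field_simp
              ring
            linarith
          have h4 := mul_le_mul_of_nonneg_left h3 hw0
          have h5 : visitedWeight σ j p q * ((1 + t) * y ^ 2) ≤ (1 + t) * y ^ 2 :=
            mul_le_of_le_one_left (by positivity) hw1
          linarith
    calc weightedSq (visitedWeight σ (j + 1)) (rotate l r θ φ A)
        ≤ ∑ p, ∑ q, (((1 + 1 / t) * (visitedWeight σ j p q * ‖A p q‖ ^ 2) + (1 + t) * y ^ 2)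
          + pairWeight l r p q * ‖rotate l r θ φ A p q‖ ^ 2) :=
          Finset.sum_le_sum fun p _ => Finset.sum_le_sum fun q _ => key p q
      _ = (1 + 1 / t) * weightedSq (visitedWeight σ j) A + n ^ 2 * ((1 + t) * y ^ 2)
          + 2 * ‖rotate l r θ φ A l r‖ ^ 2 := by
        rw [← weightedSq_pairWeight (rotate_isHermitian hH), ← sum_sum_const]
        simp only [weightedSq, Finset.sum_add_distrib, Finset.mul_sum]
      _ ≤ _ := by linarith

/-- With `t = m` the growth factors of a whole sweep compound to at most `e`. -/
theorem one_add_one_div_pow_le {m j : ℕ} (hm : 0 < m) (hj : j ≤ m) :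
    (1 + 1 / (m : ℝ)) ^ j ≤ 3 := by
  have hm' : (0 : ℝ) < m := by exact_mod_cast hm
  calc (1 + 1 / (m : ℝ)) ^ j ≤ (1 + 1 / (m : ℝ)) ^ m :=
        pow_le_pow_right₀ (by linarith [one_div_pos.mpr hm']) hj
    _ ≤ Real.exp (1 / m) ^ m := by
        refine pow_le_pow_left₀ (by positivity) ?_ m
        rw [add_comm]; exact Real.add_one_le_exp _
    _ = Real.exp 1 := by
        rw [← Real.exp_nat_mul, mul_one_div_cancel hm'.ne']
    _ ≤ 3 := by linarith [Real.exp_one_lt_d9]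

/-- Quadratic convergence of a sweep which starts with sorted clusters. -/
theorem IsSweep.offSq_sweepLength_le (hB : IsSweep η B) (h : HasSpectrum lam (B 0))
    (h0 : ∀ q, 0 ≤ lam q) (hN : ∀ q, lam q ≤ N) (hδ : 0 < δ)
    (hgap : ∀ p q, lam p ≠ lam q → 3 * δ ≤ |lam p - lam q|)
    {R : ℝ} (hR : 0 ≤ R) (hRδ : R ≤ δ / 2)
    (hoff : ∀ j ≤ sweepLength n, offSq (B j) / 2 ≤ R ^ 2) (hη : η ≤ R / δ)
    {σ : Fin n → ℝ} (hσ : Antitone σ) (hσl : ∀ i, ∃ q, lam q = σ i)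
    (hnear : ∀ j ≤ sweepLength n, ∀ i, ((B j i i).re - σ i) ^ 2 ≤ rowSq (B j) i)
    (hm : 0 < sweepLength n) :
    offSq (B (sweepLength n)) ≤ 15 / 2 * sweepLength n * (η ^ 2 * N ^ 2)
      + (3 * sweepLength n * (1 + sweepLength n) + 1) * n ^ 2 * (2 * R ^ 2 / δ) ^ 2 := by
  set m := sweepLength n with hmdef
  set y := 2 * R ^ 2 / δ with hy
  have hm' : (0 : ℝ) < m := by exact_mod_cast hm
  set K := (1 + (m : ℝ)) * (n ^ 2 * y ^ 2) + 5 / 2 * (η ^ 2 * N ^ 2) with hK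
  have hK0 : 0 ≤ K := by positivity
  have hind : ∀ j ≤ m, weightedSq (visitedWeight σ j) (B j) ≤ (1 + 1 / (m : ℝ)) ^ j * (j * K) := by
    intro j
    induction j with
    | zero =>
      intro _
      have : visitedWeight σ 0 = fun _ _ => 0 := by
        funext p q
        simp [visitedWeight, Visited]
      simp [this, weightedSq]
    | succ j ih =>
      intro hj
      have hj' := Nat.le_of_succ_le hj
      obtain ⟨⟨l, r⟩, hp⟩ := exists_getElem?_rowCyclicPairs (n := n) (j := j) hj
      obtain ⟨θ, φ, hs, he⟩ := hB j l r hp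
      rw [he]
      refine (weightedSq_visitedWeight_succ_le (hB.hasSpectrum h j hj') h0 hN hδ hgap hR hRδ
        (hoff j hj') hη hσ hσl (hnear j hj') hp hs hm').trans ?_
      have h1 : (1 : ℝ) ≤ (1 + 1 / (m : ℝ)) ^ (j + 1) :=
        one_le_pow₀ (by linarith [one_div_pos.mpr hm'])
      have h2 := mul_le_mul_of_nonneg_left (ih hj')
        (by positivity : (0 : ℝ) ≤ 1 + 1 / (m : ℝ))
      have h3 := mul_le_mul_of_nonneg_right h1 hK0
      have h4 : (1 + 1 / (m : ℝ)) * ((1 + 1 / (m : ℝ)) ^ j * (j * K))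
          = (1 + 1 / (m : ℝ)) ^ (j + 1) * (j * K) := by ring
      push_cast
      linarith
  have hsp := hB.hasSpectrum h m le_rfl
  -- At the end every pair across levels has been visited. Pairs inside a level carry no weight and
  -- are bounded through the spectrum instead.
  have hfin : offSq (B m) ≤ weightedSq (visitedWeight σ m) (B m) + n ^ 2 * y ^ 2 := by
    rw [offSq, weightedSq, weightedSq, ← sum_sum_const, ← Finset.sum_add_distrib]
    refine Finset.sum_le_sum fun p _ => ?_
    rw [← Finset.sum_add_distrib]
    refine Finset.sum_le_sum fun q _ => ?_
    have hw := mul_nonneg (visitedWeight_nonneg σ m p q) (sq_nonneg ‖B m p q‖)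
    by_cases hpq : p = q
    · rw [if_pos hpq]
      have : 0 ≤ y ^ 2 := sq_nonneg y
      linarith
    · rw [if_neg hpq, one_mul]
      by_cases hs : σ p = σ q
      · obtain ⟨q', hq'⟩ := hσl p
        have h1 := hsp.norm_apply_le_of_near (g := 3 * δ) (μ := σ p) (by positivity)
          (fun x hx => by rw [← hq'] at hx ⊢; exact hgap x q' hx) hpq (hnear m le_rfl p)
          (by rw [hs]; exact hnear m le_rfl q)
        have h2 : offSq (B m) / (3 * δ) ≤ y := by
          have h3 := hoff m le_rfl
          rw [hy, div_le_div_iff₀ (by positivity) hδ]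
          nlinarith [mul_nonneg (sq_nonneg R) hδ.le]
        have h3 := pow_le_pow_left₀ (norm_nonneg _) (h1.trans h2) 2
        linarith
      · have : visitedWeight σ m p q = 1 := by
          rw [visitedWeight, if_pos ⟨visited_sweepLength hpq, hs⟩]
        rw [this, one_mul]
        have : 0 ≤ y ^ 2 := sq_nonneg y
        linarith
  have h1 := hind m le_rfl
  have h2 := mul_le_mul_of_nonneg_right (one_add_one_div_pow_le hm (le_refl m))
    (by positivity : 0 ≤ (m : ℝ) * K)
  calc _ ≤ 3 * ((m : ℝ) * K) + n ^ 2 * y ^ 2 := by linarith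
    _ = _ := by rw [hK]; ring

end Sweep

/-! ### From single sweeps to the modified algorithm. -/

section Run

variable {n : ℕ} {G : Matrix (Fin n) (Fin n) ℂ} {W : ℕ → Matrix (Fin n) (Fin n) ℂ}
  {lam : Fin n → ℝ} {η N δ : ℝ}

theorem lt_of_pivot {k : ℕ} {l r : Fin n} (h : pivot n k = some (l, r)) : l < r :=
  lt_of_getElem?_rowCyclicPairs h

theorem IsModifiedRun.conjTranspose_mul_self (h : IsModifiedRun G η W) (k : ℕ) :
    (W k)ᴴ * W k = 1 := by
  induction k with
  | zero => rw [h.1]; simp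
  | succ k ih =>
    obtain ⟨l, r, θ, φ, hp, -, hW⟩ := h.2 k
    have hlr := (lt_of_pivot hp).ne
    have hU : (W k * jacobiRotation l r θ φ)ᴴ * (W k * jacobiRotation l r θ φ) = 1 := by
      rw [conjTranspose_mul, Matrix.mul_assoc, ← Matrix.mul_assoc (W k)ᴴ, ih, Matrix.one_mul,
        jacobiRotation_conjTranspose_mul_self hlr]
    split_ifs at hW with hd
    · obtain ⟨π, -, hπ⟩ := hW
      have he : W (k + 1) = (W k * jacobiRotation l r θ φ).submatrix id π.symm := by
        ext i j
        rw [submatrix_apply, ← hπ, Equiv.apply_symm_apply, id]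
      rw [he]
      ext i j
      have := congrFun (congrFun hU (π.symm i)) (π.symm j)
      rw [one_apply] at this ⊢
      simp only [EmbeddingLike.apply_eq_iff_eq] at this
      rw [← this]
      rfl
    · rw [hW, hU]

theorem IsModifiedRun.hasSpectrum (h : IsModifiedRun G η W) (hG : HasSpectrum lam G) (k : ℕ) :
    HasSpectrum lam (gramIterate G W k) :=
  hG.conj (h.conjTranspose_mul_self k) (mul_eq_one_comm.mp (h.conjTranspose_mul_self k))

theorem gramIterate_eq_rotate {k : ℕ} {U : Matrix (Fin n) (Fin n) ℂ} {l r : Fin n} {θ φ : ℝ}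
    (hU : U = W k * jacobiRotation l r θ φ) :
    Uᴴ * G * U = rotate l r θ φ (gramIterate G W k) := by
  rw [hU, rotate, gramIterate, conjTranspose_mul]
  simp only [Matrix.mul_assoc]

/-- The stages of sweep `q` form a row-cyclic sweep, whose result is sorted. -/
theorem IsModifiedRun.exists_isSweep (h : IsModifiedRun G η W) (hm : 0 < sweepLength n) (q : ℕ) :
    ∃ B : ℕ → Matrix (Fin n) (Fin n) ℂ,
      (∀ j < sweepLength n, B j = gramIterate G W (q * sweepLength n + j)) ∧ IsSweep η B ∧
      ∃ π : Equiv.Perm (Fin n), IsSortingPerm G W q π ∧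
        ∀ i j, gramIterate G W ((q + 1) * sweepLength n) (π i) (π j) = B (sweepLength n) i j := by
  set m := sweepLength n with hmdef
  have hpiv : ∀ j < m, pivot n (q * m + j) = (rowCyclicPairs n)[j]? := by
    intro j hj
    rw [pivot, ← hmdef, Nat.mul_add_mod_self_right, Nat.mod_eq_of_lt hj]
  have hk : q * m + (m - 1) + 1 = (q + 1) * m := by
    rw [Nat.add_assoc, Nat.sub_add_cancel hm, Nat.succ_mul]
  obtain ⟨l, r, θ, φ, hp, hs, hW⟩ := h.2 (q * m + (m - 1))
  rw [hk, if_pos (Dvd.intro_left _ rfl)] at hW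
  obtain ⟨π, hπ, hWπ⟩ := hW
  have hq : (q * m + (m - 1)) / m = q := by
    rw [Nat.add_comm, Nat.add_mul_div_right _ _ hm, Nat.div_eq_of_lt (Nat.sub_lt hm one_pos),
      Nat.zero_add]
  rw [← hmdef, hq] at hπ
  -- The run never stores the last matrix before sorting, so `B m` is defined as the rotated last
  -- stage; the next iterate is its reindexing.
  refine ⟨fun j => if j < m then gramIterate G W (q * m + j) else
    rotate l r θ φ (gramIterate G W (q * m + (m - 1))), fun j hj => if_pos hj, ?_, π, hπ, ?_⟩
  · intro j a b hab
    have hj : j < m := by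
      rw [hmdef, ← length_rowCyclicPairs]
      exact (List.getElem?_eq_some_iff.mp hab).1
    beta_reduce
    rw [if_pos hj]
    by_cases hj1 : j + 1 < m
    · obtain ⟨l', r', θ', φ', hp', hs', hW'⟩ := h.2 (q * m + j)
      rw [hpiv j hj, hab, Option.some.injEq, Prod.mk.injEq] at hp'
      obtain ⟨rfl, rfl⟩ := hp'
      have hnd : ¬ m ∣ q * m + j + 1 := by
        rw [Nat.add_assoc, Nat.dvd_add_right (Dvd.intro_left _ rfl)]
        exact fun hd => absurd (Nat.le_of_dvd (Nat.succ_pos j) hd) (by omega)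
      rw [if_neg hnd] at hW'
      refine ⟨θ', φ', hs', ?_⟩
      rw [if_pos hj1]
      exact gramIterate_eq_rotate hW'
    · have hjm : j = m - 1 := by omega
      subst hjm
      rw [hpiv _ hj, hab, Option.some.injEq, Prod.mk.injEq] at hp
      obtain ⟨rfl, rfl⟩ := hp
      exact ⟨θ, φ, hs, if_neg hj1⟩
  · intro i j
    simp only [lt_irrefl, if_false]
    rw [← gramIterate_eq_rotate rfl]
    have hcol : ∀ i j, W ((q + 1) * m) i (π j) = (W (q * m + (m - 1)) * jacobiRotation l r θ φ) i j :=
      hWπ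
    simp only [gramIterate, Matrix.mul_apply (M := _ * G), Matrix.mul_apply (N := G),
      conjTranspose_apply, hcol]

theorem rowSq_of_reindex {A B : Matrix (Fin n) (Fin n) ℂ} (π : Equiv.Perm (Fin n))
    (h : ∀ i j, B (π i) (π j) = A i j) (i : Fin n) : rowSq B (π i) = rowSq A i := by
  rw [rowSq, rowSq, ← Equiv.sum_comp π]
  simp [h]

theorem IsModifiedRun.offSq_le (h : IsModifiedRun G η W) (hm : 0 < sweepLength n)
    (hG : HasSpectrum lam G) (h0 : ∀ q, 0 ≤ lam q) (hN : ∀ q, lam q ≤ N) (q : ℕ) :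
    offSq (gramIterate G W ((q + 1) * sweepLength n))
      ≤ offSq (gramIterate G W (q * sweepLength n))
        + sweepLength n * (5 / 2 * (η ^ 2 * N ^ 2)) := by
  obtain ⟨B, hBg, hB, π, -, hπ⟩ := h.exists_isSweep hm q
  have hB0 : B 0 = gramIterate G W (q * sweepLength n) := hBg 0 hm
  rw [offSq_of_reindex π hπ, ← hB0]
  exact hB.offSq_le (hB0 ▸ h.hasSpectrum hG _) h0 hN _ le_rfl

/-- After a sweep with sufficient accuracy the diagonal entries are close to eigenvalues in
decreasing order. -/
theorem IsModifiedRun.exists_antitone_near (h : IsModifiedRun G η W) (hm : 0 < sweepLength n)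
    (hG : HasSpectrum lam G) (h0 : ∀ q, 0 ≤ lam q) (hN : ∀ q, lam q ≤ N) (hN0 : 0 ≤ N)
    (hδ : 0 < δ) (hgap : ∀ p q, lam p ≠ lam q → 3 * δ ≤ |lam p - lam q|) (q : ℕ)
    (hoff : offSq (gramIterate G W (q * sweepLength n)) / 2
      + sweepLength n * (5 / 4 * (η ^ 2 * N ^ 2)) ≤ (δ / 2) ^ 2) (hη : η * N ≤ δ / 4) :
    ∃ σ : Fin n → ℝ, Antitone σ ∧ (∀ i, ∃ q, lam q = σ i) ∧
      ∀ i, ((gramIterate G W ((q + 1) * sweepLength n) i i).re - σ i) ^ 2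
        ≤ rowSq (gramIterate G W ((q + 1) * sweepLength n)) i := by
  obtain ⟨B, hBg, hB, π, hsort, hπ⟩ := h.exists_isSweep hm q
  set m := sweepLength n with hmdef
  have hB0 : B 0 = gramIterate G W (q * m) := hBg 0 hm
  have hsp0 : HasSpectrum lam (B 0) := hB0 ▸ h.hasSpectrum hG _
  have hoffB : ∀ j ≤ m, offSq (B j) / 2 ≤ (δ / 2) ^ 2 := by
    intro j hj
    have h1 := hB.offSq_le hsp0 h0 hN j hj
    rw [hB0] at h1
    have h2 : (j : ℝ) * (5 / 2 * (η ^ 2 * N ^ 2)) ≤ m * (5 / 2 * (η ^ 2 * N ^ 2)) := by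
      have : (j : ℝ) ≤ m := by exact_mod_cast hj
      gcongr
    linarith
  choose f hf using fun i => hsp0.exists_near i
  have hnear := hB.near hsp0 h0 hN hN0 hδ hgap hoffB hη (σ := fun i => lam (f i))
    (fun i => ⟨_, rfl⟩) hf
  have hdiag : ∀ j ≤ m, ∀ i, |(B j i i).re - lam (f i)| ≤ δ / 2 := fun j hj i =>
    abs_le_of_sq_le_sq ((hnear j hj i).trans
      ((rowSq_le_offSq (hB.hasSpectrum hsp0 j hj).isHermitian i).trans (hoffB j hj)))
      (by positivity)
  have hlt : ∀ a b, lam (f b) < lam (f a) → π a < π b := by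
    intro a b hab
    -- This set is a union of clusters, and its diagonal entries exceed the others by at least `3 *
    -- δ - δ` at every stage. Comparisons inside a cluster may be intransitive without harm.
    refine hsort {i | lam (f b) < lam (f i)} ?_ a hab b (lt_irrefl (lam (f b)))
    intro i hi j hj
    have hij : lam (f j) < lam (f i) := (not_lt.mp hj).trans_lt hi
    have hg := hgap _ _ hij.ne'
    rw [abs_of_pos (sub_pos.mpr hij)] at hg
    have hne : i ≠ j := by rintro rfl; exact lt_irrefl _ hij
    obtain ⟨t, ht, hp⟩ := visited_sweepLength hne
    have hpiv : pivot n (q * m + t) = (rowCyclicPairs n)[t]? := by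
      rw [pivot, ← hmdef, Nat.mul_add_mod_self_right, Nat.mod_eq_of_lt ht]
    have h1 := abs_le.mp (hdiag t ht.le i)
    have h2 := abs_le.mp (hdiag t ht.le j)
    rw [hBg t ht] at h1 h2
    refine ⟨q * m + t, Nat.le_add_right _ _, ?_, ?_⟩
    · rw [Nat.succ_mul]
      exact Nat.add_lt_add_left ht _
    · rw [hpiv]
      rcases hp with hp | hp
      · exact Or.inl ⟨hp, by linarith [h1.1, h2.2]⟩
      · exact Or.inr ⟨hp, by linarith [h1.1, h2.2]⟩
  refine ⟨fun i => lam (f (π.symm i)), ?_, fun i => ⟨_, rfl⟩, ?_⟩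
  · intro x y hxy
    by_contra! hcon
    have := hlt _ _ hcon
    rw [Equiv.apply_symm_apply, Equiv.apply_symm_apply] at this
    exact absurd hxy (not_le.mpr this)
  · intro i
    obtain ⟨i, rfl⟩ := π.surjective i
    beta_reduce
    rw [rowSq_of_reindex π hπ, hπ, Equiv.symm_apply_apply]
    exact hnear m le_rfl i

theorem cast_sweepLength (n : ℕ) : 4 * (sweepLength n : ℝ) = 2 * ((n : ℝ) ^ 2 - n) := by
  have h : sweepLength n * 2 = n * (n - 1) :=
    Nat.div_mul_cancel (Nat.even_mul_pred_self n).two_dvd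
  have h2 : (sweepLength n : ℝ) * 2 = n * (n - 1) := by
    rcases n with _ | n
    · simp [sweepLength]
    · have h3 : ((sweepLength (n + 1) * 2 : ℕ) : ℝ) = (((n + 1) * (n + 1 - 1) : ℕ) : ℝ) := by rw [h]
      push_cast at h3
      push_cast
      linarith
  linarith

/-- The constant of quadratic convergence. -/
noncomputable def convergenceConst (n : ℕ) : ℝ :=
  64 * ((sweepLength n : ℝ) + 1) ^ 2
    + 2 * (3 * sweepLength n * (1 + sweepLength n) + 1) * n ^ 2 * ((sweepLength n : ℝ) + 1) ^ 4

theorem convergenceConst_nonneg (n : ℕ) : 0 ≤ convergenceConst n := by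
  rw [convergenceConst]; positivity

/-- One threshold meets both needs of a sweep: the accumulated noise does not push the squared
off-diagonal norm from `δ ^ 2 / 8` beyond `δ ^ 2 / 4`, and diagonal entries cannot change clusters.
-/
theorem accuracy_le {x δ m : ℝ} (hm : 0 ≤ m) (hx : 0 ≤ x)
    (h : x ≤ 1 / (8 * (m + 1)) * δ) : m * (5 / 4 * x ^ 2) ≤ δ ^ 2 / 8 ∧ (0 ≤ δ → x ≤ δ / 4) := by
  rw [one_div_mul_eq_div, le_div_iff₀ (by positivity)] at h
  constructor
  · have h1 : (x * (8 * (m + 1))) ^ 2 ≤ δ ^ 2 := pow_le_pow_left₀ (by positivity) h 2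
    nlinarith [mul_nonneg (sq_nonneg x) hm, mul_nonneg (sq_nonneg x) (sq_nonneg m), sq_nonneg x]
  · intro hδ
    nlinarith [mul_nonneg hx hm]

/-- The quadratic convergence of the modified algorithm. -/
theorem IsModifiedRun.offSq_succ_succ_le (h : IsModifiedRun G η W) (hη0 : 0 ≤ η)
    (hm : 0 < sweepLength n)
    (hG : HasSpectrum lam G) (h0 : ∀ q, 0 ≤ lam q) (hN : ∀ q, lam q ≤ N)
    (hδ : 0 < δ) (hδN : 3 * δ ≤ N)
    (hgap : ∀ p q, lam p ≠ lam q → 3 * δ ≤ |lam p - lam q|) (q : ℕ)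
    (hoff : offSq (gramIterate G W (q * sweepLength n)) / 2 < δ ^ 2 / 8) :
    offSq (gramIterate G W ((q + 2) * sweepLength n)) / 2
      ≤ convergenceConst n * (offSq (gramIterate G W ((q + 1) * sweepLength n)) / 2 / δ) ^ 2
        + 4 * sweepLength n * (η * N) ^ 2 := by
  have hN0 : 0 ≤ N := by linarith
  have hbase := h.offSq_le hm hG h0 hN (q + 1)
  have hS0 := offSq_nonneg (gramIterate G W ((q + 1) * sweepLength n))
  have hm1 : (1 : ℝ) ≤ sweepLength n := by exact_mod_cast hm
  set p := √(offSq (gramIterate G W ((q + 1) * sweepLength n)) / 2) with hp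
  have hp0 : 0 ≤ p := Real.sqrt_nonneg _
  have hpsq : p ^ 2 = offSq (gramIterate G W ((q + 1) * sweepLength n)) / 2 :=
    Real.sq_sqrt (by linarith)
  rw [← hpsq]
  have hC1 : 64 * ((sweepLength n : ℝ) + 1) ^ 2 ≤ convergenceConst n := by
    rw [convergenceConst]
    have : 0 ≤ 2 * (3 * (sweepLength n : ℝ) * (1 + sweepLength n) + 1) * n ^ 2
      * ((sweepLength n : ℝ) + 1) ^ 4 := by positivity
    linarith
  have hC0 : 0 ≤ convergenceConst n := le_trans (by positivity) hC1
  have hbase' : offSq (gramIterate G W ((q + 2) * sweepLength n)) / 2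
      ≤ p ^ 2 + sweepLength n * (5 / 4 * (η * N) ^ 2) := by
    rw [hpsq, mul_pow]; linarith
  have hx0 : 0 ≤ η * N := mul_nonneg hη0 hN0
  -- If `p` is below the noise level, the noise term alone absorbs the crude one-sweep bound.
  rcases le_or_gt p (η * N) with hcase | hcase
  · refine hbase'.trans ?_
    have h1 := pow_le_pow_left₀ hp0 hcase 2
    have h2 : 0 ≤ convergenceConst n * (p ^ 2 / δ) ^ 2 := by positivity
    nlinarith [sq_nonneg (η * N)]
  -- If `p` is comparable to `δ`, then `p ^ 2` is itself at most a multiple of `(p ^ 2 / δ) ^ 2`. In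
  -- the remaining case noise is dominated by `p` and both are small compared with `δ`.
  rcases le_or_gt (1 / (8 * ((sweepLength n : ℝ) + 1)) * δ) p with hcase2 | hcase2
  · refine hbase'.trans ?_
    rw [one_div_mul_eq_div, div_le_iff₀ (by positivity)] at hcase2
    have h1 : δ ^ 2 ≤ (p * (8 * ((sweepLength n : ℝ) + 1))) ^ 2 :=
      pow_le_pow_left₀ hδ.le hcase2 2
    have h2 : p ^ 2 ≤ 64 * ((sweepLength n : ℝ) + 1) ^ 2 * (p ^ 2 / δ) ^ 2 := by
      rw [div_pow, ← mul_div_assoc, le_div_iff₀ (by positivity)]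
      nlinarith [sq_nonneg p]
    have h3 := mul_le_mul_of_nonneg_right hC1 (sq_nonneg (p ^ 2 / δ))
    nlinarith [sq_nonneg (η * N)]
  · have hacc := accuracy_le (by linarith : (0 : ℝ) ≤ sweepLength n) hx0
      (hcase.le.trans hcase2.le)
    obtain ⟨σ, hσ, hσl, hnear⟩ := h.exists_antitone_near hm hG h0 hN hN0 hδ hgap q
      (by rw [← mul_pow]; linarith [hacc.1]) (hacc.2 hδ.le)
    obtain ⟨B, hBg, hB, π, -, hπ⟩ := h.exists_isSweep hm (q + 1)
    have hB0 : B 0 = gramIterate G W ((q + 1) * sweepLength n) := hBg 0 hm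
    have hsp0 : HasSpectrum lam (B 0) := hB0 ▸ h.hasSpectrum hG _
    -- As the noise per step is below `p`, this `R` bounds the off-diagonal norm throughout the
    -- sweep.
    set R := ((sweepLength n : ℝ) + 1) * p with hR
    have hR0 : 0 ≤ R := by positivity
    have hRδ : R ≤ δ / 2 := by
      rw [one_div_mul_eq_div, lt_div_iff₀ (by positivity)] at hcase2
      rw [hR]; linarith
    have hoffR : ∀ j ≤ sweepLength n, offSq (B j) / 2 ≤ R ^ 2 := by
      intro j hj
      have h1 := hB.offSq_le hsp0 h0 hN j hj
      rw [hB0, ← mul_pow] at h1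
      have h2 : (j : ℝ) * (5 / 2 * (η * N) ^ 2) ≤ sweepLength n * (5 / 2 * p ^ 2) := by
        have : (j : ℝ) ≤ sweepLength n := by exact_mod_cast hj
        have := pow_le_pow_left₀ hx0 hcase.le 2
        gcongr
      rw [hR, mul_pow]
      nlinarith [sq_nonneg p, mul_nonneg (sq_nonneg p) (sq_nonneg (sweepLength n : ℝ))]
    have hηR : η ≤ R / δ := by
      rw [le_div_iff₀ hδ]
      have h1 : η * δ ≤ η * N := mul_le_mul_of_nonneg_left (by linarith) hη0
      have h2 : p ≤ R := by rw [hR]; nlinarith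
      linarith
    have hnearB := hB.near hsp0 h0 hN hN0 hδ hgap
      (fun j hj => (hoffR j hj).trans (pow_le_pow_left₀ hR0 hRδ 2)) (hacc.2 hδ.le) hσl
      (by rw [hB0]; exact hnear)
    have hfin := hB.offSq_sweepLength_le hsp0 h0 hN hδ hgap hR0 hRδ hoffR hηR hσ hσl hnearB hm
    rw [show q + 2 = q + 1 + 1 from rfl, offSq_of_reindex π hπ]
    have hy : (2 * R ^ 2 / δ) ^ 2 = 4 * ((sweepLength n : ℝ) + 1) ^ 4 * (p ^ 2 / δ) ^ 2 := by
      rw [hR]; ring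
    rw [hy] at hfin
    have h1 : 64 * ((sweepLength n : ℝ) + 1) ^ 2 * (p ^ 2 / δ) ^ 2 ≥ 0 := by positivity
    have h2 : 0 ≤ (sweepLength n : ℝ) * (η ^ 2 * N ^ 2) := by positivity
    rw [convergenceConst, mul_pow]
    linarith

end Run

/-! ### Spectral norm, eigenvalue gap and the null space. -/

section Interference

variable {nr nt : ℕ}

theorem eigenvalues_le_opNorm {n : ℕ} {G : Matrix (Fin n) (Fin n) ℂ} (hG : G.IsHermitian)
    (q : Fin n) : hG.eigenvalues q ≤ opNorm G := by
  have h1 := (Matrix.toEuclideanCLM (n := Fin n) (𝕜 := ℂ) G).le_opNorm (hG.eigenvectorBasis q)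
  have h2 : Matrix.toEuclideanCLM (n := Fin n) (𝕜 := ℂ) G (hG.eigenvectorBasis q)
      = (hG.eigenvalues q : ℂ) • hG.eigenvectorBasis q := by
    have := hG.mulVec_eigenvectorBasis q
    ext i
    have h3 := congrFun this i
    simpa using h3
  rw [h2, norm_smul, hG.eigenvectorBasis.orthonormal.1 q, mul_one, mul_one, Complex.norm_real] at h1
  exact (le_abs_self _).trans h1

theorem three_mul_gapThird_le {n : ℕ} {G : Matrix (Fin n) (Fin n) ℂ} (hG : G.IsHermitian)
    {p q : Fin n} (h : hG.eigenvalues p ≠ hG.eigenvalues q) :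
    3 * gapThird hG ≤ |hG.eigenvalues p - hG.eigenvalues q| := by
  rw [gapThird, mul_div_cancel₀ _ (by norm_num)]
  refine csInf_le ⟨0, ?_⟩ ⟨p, q, h, rfl⟩
  rintro _ ⟨i, j, -, rfl⟩
  exact abs_nonneg _

theorem gapThird_nonneg {n : ℕ} {G : Matrix (Fin n) (Fin n) ℂ} (hG : G.IsHermitian) :
    0 ≤ gapThird hG := by
  refine div_nonneg (Real.sInf_nonneg ?_) (by norm_num)
  rintro _ ⟨i, j, -, rfl⟩
  exact abs_nonneg _

/-- The infimum of the empty set is `0` by convention, so a nonzero gap has a witness; the bound `3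
* δ ≤ ‖G‖` rests on it. -/
theorem exists_eigenvalues_ne_of_gapThird_ne_zero {n : ℕ} {G : Matrix (Fin n) (Fin n) ℂ}
    (hG : G.IsHermitian) (h : gapThird hG ≠ 0) :
    ∃ p q, hG.eigenvalues p ≠ hG.eigenvalues q := by
  by_contra! hcon
  apply h
  have : {d : ℝ | ∃ i j, hG.eigenvalues i ≠ hG.eigenvalues j ∧
      d = |hG.eigenvalues i - hG.eigenvalues j|} = ∅ := by
    ext d
    exact ⟨fun ⟨i, j, hij, _⟩ => hij (hcon i j), False.elim⟩
  rw [gapThird, this, Real.sInf_empty, zero_div]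

theorem interference_sq (H : Matrix (Fin nr) (Fin nt) ℂ) (W : ℕ → Matrix (Fin nt) (Fin nt) ℂ)
    (k : ℕ) (i : Fin nt) :
    interference H (W k) i ^ 2 = (gramIterate (Hᴴ * H) W k i i).re := by
  have h1 : gramIterate (Hᴴ * H) W k = (H * W k)ᴴ * (H * W k) := by
    rw [gramIterate, conjTranspose_mul]
    simp only [Matrix.mul_assoc]
  rw [h1, interference, EuclideanSpace.norm_sq_eq, Matrix.mul_apply]
  simp only [conjTranspose_apply, Complex.star_def, Complex.conj_mul']
  rw [← Complex.ofReal_re (∑ _, _)]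
  push_cast
  rfl

open scoped ComplexOrder in
theorem eigenvalues_conjTranspose_mul_self_nonneg (H : Matrix (Fin nr) (Fin nt) ℂ) (q : Fin nt) :
    0 ≤ (isHermitian_conjTranspose_mul_self H).eigenvalues q :=
  (posSemidef_conjTranspose_mul_self H).eigenvalues_nonneg q

open scoped ComplexOrder in
theorem card_eigenvalues_conjTranspose_mul_self_eq_zero (H : Matrix (Fin nr) (Fin nt) ℂ) :
    (Finset.univ.filter fun q =>
      (isHermitian_conjTranspose_mul_self H).eigenvalues q = 0).card + H.rank = nt := by
  rw [← rank_conjTranspose_mul_self,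
    (isHermitian_conjTranspose_mul_self H).rank_eq_card_non_zero_eigs, Fintype.card_subtype,
    Finset.card_filter_add_card_filter_not, Finset.card_univ, Fintype.card_fin]

/-- Zero is the least possible value, so its level is a final segment, determined by its
cardinality. -/
theorem eq_zero_iff_of_antitone {n k : ℕ} {σ : Fin n → ℝ} (hσ : Antitone σ) (h0 : ∀ i, 0 ≤ σ i)
    (hcard : (Finset.univ.filter fun i => σ i = 0).card + k = n) (i : Fin n) :
    σ i = 0 ↔ k ≤ i := by
  constructor
  · intro hi
    have h1 : Finset.Ici i ⊆ Finset.univ.filter fun i => σ i = 0 := by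
      intro a ha
      rw [Finset.mem_Ici] at ha
      simp only [Finset.mem_filter, Finset.mem_univ, true_and]
      exact le_antisymm (hi ▸ hσ ha) (h0 a)
    have h2 := Finset.card_le_card h1
    rw [Fin.card_Ici] at h2
    omega
  · intro hi
    by_contra hne
    have h1 : (Finset.univ.filter fun i => σ i = 0) ⊆ Finset.Ioi i := by
      intro a ha
      simp only [Finset.mem_filter, Finset.mem_univ, true_and] at ha
      rw [Finset.mem_Ioi]
      by_contra! hle
      exact hne (le_antisymm (ha ▸ hσ hle) (h0 i))
    have h2 := Finset.card_le_card h1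
    rw [Fin.card_Ioi] at h2
    omega

end Interference

end OBNSLA

/-! ### Assembly of the three claims. -/

theorem theorem3 (nt : ℕ) :
    ∃ C : ℝ, 0 < C ∧ ∃ c : ℝ, 0 < c ∧
      ∀ (nr : ℕ) (H : Matrix (Fin nr) (Fin nt) ℂ), 0 < nr → nr < nt → H.rank = nr →
      ∀ (η : ℝ), 0 ≤ η →
      ∀ (W : ℕ → Matrix (Fin nt) (Fin nt) ℂ),
        OBNSLA.IsModifiedRun (H.conjTranspose * H) η W →
      ∀ (δ : ℝ), δ = OBNSLA.gapThird (Matrix.isHermitian_conjTranspose_mul_self H) →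
      ∀ (m k : ℕ), m = nt * (nt - 1) / 2 → m ∣ k →
        OBNSLA.P (H.conjTranspose * H) W k ^ 2 < δ ^ 2 / 8 →
        -- the bound after the next sweep
        (OBNSLA.P (H.conjTranspose * H) W (k + 2 * m) ^ 2 ≤
          C * (OBNSLA.P (H.conjTranspose * H) W (k + m) ^ 2 / δ) ^ 2
          + C * (η * OBNSLA.P (H.conjTranspose * H) W (k + m) ^ (3 / 2 : ℝ) / δ)
          + C * (η ^ 2 * OBNSLA.P (H.conjTranspose * H) W (k + m) ^ (1 / 2 : ℝ) / δ)
          + 2 * ((nt : ℝ) ^ 2 - nt) * η ^ 2 * OBNSLA.opNorm (H.conjTranspose * H) ^ 2) ∧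
        -- quadratic convergence, as long as the accuracy is fine enough
        (η * OBNSLA.opNorm (H.conjTranspose * H) * δ
            ≤ OBNSLA.P (H.conjTranspose * H) W (k + m) ^ 2 →
          OBNSLA.P (H.conjTranspose * H) W (k + 2 * m)
            ≤ C * (OBNSLA.P (H.conjTranspose * H) W (k + m) ^ 2 / δ)) ∧
        -- the last columns give the minimal interference
        (η * OBNSLA.opNorm (H.conjTranspose * H) ≤ c * δ →
          ∀ i j : Fin nt, (j : ℕ) < nr → nr ≤ (i : ℕ) →
            OBNSLA.interference H (W (k + m)) i ≤ OBNSLA.interference H (W (k + m)) j) := by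
  refine ⟨OBNSLA.convergenceConst nt + 4 * OBNSLA.sweepLength nt + 1, ?_,
    1 / (8 * ((OBNSLA.sweepLength nt : ℝ) + 1)), by positivity, ?_⟩
  · have := OBNSLA.convergenceConst_nonneg nt
    positivity
  intro nr H hnr hnrt hrank η hη0 W hrun δ hδdef m k hmdef hmk hPk
  have hC1 := OBNSLA.convergenceConst_nonneg nt
  have hG := Matrix.isHermitian_conjTranspose_mul_self H
  have hsp := OBNSLA.IsHermitian.hasSpectrum hG
  have h0 : ∀ q, 0 ≤ hG.eigenvalues q :=
    OBNSLA.eigenvalues_conjTranspose_mul_self_nonneg H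
  have hN := OBNSLA.eigenvalues_le_opNorm hG
  have hgap : ∀ p q, hG.eigenvalues p ≠ hG.eigenvalues q →
      3 * δ ≤ |hG.eigenvalues p - hG.eigenvalues q| := fun p q hpq =>
    hδdef ▸ OBNSLA.three_mul_gapThird_le hG hpq
  -- The strict bound on `P` at stage `k` excludes the degenerate value `0`.
  have hδ : 0 < δ := by
    refine lt_of_le_of_ne (hδdef ▸ OBNSLA.gapThird_nonneg hG) ?_
    rintro rfl
    have := sq_nonneg (OBNSLA.P (H.conjTranspose * H) W k)
    norm_num at hPk
    linarith
  have hδN : 3 * δ ≤ OBNSLA.opNorm (H.conjTranspose * H) := by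
    obtain ⟨p, q, hpq⟩ := OBNSLA.exists_eigenvalues_ne_of_gapThird_ne_zero hG (hδdef ▸ hδ.ne')
    refine (hgap p q hpq).trans (abs_le.mpr ⟨?_, ?_⟩)
    · linarith [h0 p, hN q]
    · linarith [h0 q, hN p]
  have hm : 0 < OBNSLA.sweepLength nt := by
    rw [OBNSLA.sweepLength]
    refine Nat.div_pos ?_ (by norm_num)
    calc 2 = 2 * 1 := rfl
      _ ≤ nt * (nt - 1) := Nat.mul_le_mul (by omega) (by omega)
  have hm1 : (1 : ℝ) ≤ OBNSLA.sweepLength nt := by exact_mod_cast hm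
  obtain ⟨q, rfl⟩ := hmk
  have hm2 : m = OBNSLA.sweepLength nt := hmdef
  clear hmdef
  subst hm2
  have hP : ∀ j, OBNSLA.P (H.conjTranspose * H) W j ^ 2
      = OBNSLA.offSq (OBNSLA.gramIterate (H.conjTranspose * H) W j) / 2 := fun j =>
    OBNSLA.offNorm_sq (hrun.hasSpectrum hsp j).isHermitian
  have hP0 : ∀ j, 0 ≤ OBNSLA.P (H.conjTranspose * H) W j := fun j => Real.sqrt_nonneg _
  have e0 : OBNSLA.sweepLength nt * q = q * OBNSLA.sweepLength nt := Nat.mul_comm _ _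
  have e1 : OBNSLA.sweepLength nt * q + OBNSLA.sweepLength nt
      = (q + 1) * OBNSLA.sweepLength nt := by ring
  have e2 : OBNSLA.sweepLength nt * q + 2 * OBNSLA.sweepLength nt
      = (q + 2) * OBNSLA.sweepLength nt := by ring
  rw [e1, e2]
  rw [e0, hP] at hPk
  have hquad := hrun.offSq_succ_succ_le hη0 hm hsp h0 hN hδ hδN hgap q hPk
  rw [← hP, ← hP] at hquad
  set x := OBNSLA.P (H.conjTranspose * H) W ((q + 1) * OBNSLA.sweepLength nt) with hx
  set N := OBNSLA.opNorm (H.conjTranspose * H) with hNdef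
  have hN0 : 0 ≤ N := by linarith
  have hx0 : 0 ≤ x := hP0 _
  refine ⟨?_, ?_, ?_⟩
  -- The noise coefficient is exactly `4 * m`; the two mixed terms are nonnegative and only add
  -- slack.
  · rw [mul_assoc _ (η ^ 2) (N ^ 2), ← OBNSLA.cast_sweepLength, ← mul_pow]
    have h1 : 0 ≤ (OBNSLA.convergenceConst nt + 4 * OBNSLA.sweepLength nt + 1)
        * (η * x ^ (3 / 2 : ℝ) / δ) := by positivity
    have h2 : 0 ≤ (OBNSLA.convergenceConst nt + 4 * OBNSLA.sweepLength nt + 1)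
        * (η ^ 2 * x ^ (1 / 2 : ℝ) / δ) := by positivity
    have h3 : 0 ≤ (4 * (OBNSLA.sweepLength nt : ℝ) + 1) * (x ^ 2 / δ) ^ 2 := by positivity
    linarith
  · intro hfine
    have h1 : η * N ≤ x ^ 2 / δ := by rwa [le_div_iff₀ hδ]
    have h2 := pow_le_pow_left₀ (mul_nonneg hη0 hN0) h1 2
    have h3 : 0 ≤ x ^ 2 / δ := by positivity
    -- Under fine accuracy the noise is also a multiple of `(x ^ 2 / δ) ^ 2`. The summand `1` in the
    -- constant lets its square dominate the combined factor.
    refine le_of_sq_le_sq ?_ (by positivity)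
    have h4 := mul_le_mul_of_nonneg_left h2
      (by positivity : 0 ≤ 4 * (OBNSLA.sweepLength nt : ℝ))
    have h5 : OBNSLA.convergenceConst nt + 4 * OBNSLA.sweepLength nt
        ≤ (OBNSLA.convergenceConst nt + 4 * OBNSLA.sweepLength nt + 1) ^ 2 := by nlinarith
    have h6 := mul_le_mul_of_nonneg_right h5 (sq_nonneg (x ^ 2 / δ))
    rw [mul_pow]
    linarith
  · intro hfine i j hj hi
    have hacc := OBNSLA.accuracy_le (by linarith : (0 : ℝ) ≤ OBNSLA.sweepLength nt)
      (mul_nonneg hη0 hN0) hfine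
    have hstart : OBNSLA.offSq (OBNSLA.gramIterate (H.conjTranspose * H) W
        (q * OBNSLA.sweepLength nt)) / 2
        + OBNSLA.sweepLength nt * (5 / 4 * (η ^ 2 * N ^ 2)) ≤ (δ / 2) ^ 2 := by
      rw [← mul_pow]
      linarith [hacc.1]
    obtain ⟨σ, hσ, hσl, hnear⟩ := hrun.exists_antitone_near hm hsp h0 hN hN0 hδ hgap q hstart
      (hacc.2 hδ.le)
    have hspk := hrun.hasSpectrum hsp ((q + 1) * OBNSLA.sweepLength nt)
    have hoff : OBNSLA.offSq (OBNSLA.gramIterate (H.conjTranspose * H) W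
        ((q + 1) * OBNSLA.sweepLength nt)) / 2 ≤ (δ / 2) ^ 2 := by
      have := hrun.offSq_le hm hsp h0 hN q
      linarith
    have hcard := hspk.card_near_eq (g := 3 * δ) (by positivity) (σ := σ)
      (fun a b hab => by
        obtain ⟨p, hp⟩ := hσl a
        rw [← hp] at hab ⊢
        exact hgap b p hab) hnear (by nlinarith) 0
    have hrk := OBNSLA.card_eigenvalues_conjTranspose_mul_self_eq_zero H
    rw [hrank, ← hcard] at hrk
    have hσ0 : ∀ a, 0 ≤ σ a := fun a => by
      obtain ⟨p, hp⟩ := hσl a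
      exact hp ▸ h0 p
    have hzero := OBNSLA.eq_zero_iff_of_antitone hσ hσ0 hrk
    have hσi : σ i = 0 := (hzero i).mpr hi
    have hσj : σ j ≠ 0 := fun h => absurd ((hzero j).mp h) (not_le.mpr hj)
    have hdiag : ∀ a, |(OBNSLA.gramIterate (H.conjTranspose * H) W
        ((q + 1) * OBNSLA.sweepLength nt) a a).re - σ a| ≤ δ / 2 := fun a =>
      abs_le_of_sq_le_sq ((hnear a).trans
        ((OBNSLA.rowSq_le_offSq hspk.isHermitian a).trans hoff)) (by positivity)
    -- Position `i` has eigenvalue zero, so the gap separates `σ j` from zero; errors of `δ / 2` on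
    -- each diagonal entry cannot reverse the order.
    have hlarge : 3 * δ ≤ σ j := by
      obtain ⟨p, hp⟩ := hσl j
      obtain ⟨p', hp'⟩ := hσl i
      have := hgap p p' (by rw [hp, hp', hσi]; exact hσj)
      rwa [hp, hp', hσi, sub_zero, abs_of_nonneg (hσ0 j)] at this
    refine le_of_sq_le_sq ?_ (norm_nonneg _)
    rw [OBNSLA.interference_sq, OBNSLA.interference_sq]
    have h1 := abs_le.mp (hdiag i)
    have h2 := abs_le.mp (hdiag j)
    rw [hσi] at h1
    linarith [h1.2, h2.1]
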